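/- Let $n\ge 1$ and $1<p<\infty$. For $x\in\mathbb R^n$, $t\in\mathbb R$ and $L>0$ let $Q(x,L)=\{y\in\mathbb R^n:|y_i-x_i|\le L,\ i=1,\dots,n\}$, and let $R=R(x,t,L)=Q(x,L)\times(t-L^p,t+L^p)\subset\mathbb R^{n+1}$ be the parabolic rectangle with upper and lower parts $$R^+(\gamma)=Q(x,L)\times(t+\gamma L^p,t+L^p),\qquad R^-(\gamma)=Q(x,L)\times(t-L^p,t-\gamma L^p),\qquad 0\le\gamma<1.$$ A weight is a nonnegative locally integrable function $w$ on $\mathbb R^{n+1}$. For $1<q<\infty$, a weight $w$ belongs to $A_q^+(\gamma)$ if $$[w]_{A_q^+(\gamma)}=\sup_{R}\Bigl(\frac1{|R^-(\gamma)|}\int_{R^-(\gamma)}w\Bigr)\Bigl(\frac1{|R^+(\gamma)|}\int_{R^+(\gamma)}w^{\frac1{1-q}}\Bigr)^{q-1}<\infty,$$ where the supremum is taken over all parabolic rectangles $R\subset\mathbb R^{n+1}$, $w^{1/(1-q)}=\infty$ where $w=0$, and $0\cdot\infty=0$. Let $1<q<\infty$, $0<\gamma<1$ and $0\le K<\infty$.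 Then there exists $\varepsilon\in(0,q-1)$, depending only on $n,p,q,\gamma$ and $K$, such that every $w\in A_q^+(\gamma)$ with $[w]_{A_q^+(\gamma)}\le K$ belongs to $A_{q-\varepsilon}^+(\gamma')$ for every $0<\gamma'<1$, with $[w]_{A_{q-\varepsilon}^+(\gamma')}\le C$, where $C<\infty$ depends only on $n,p,q,\gamma,K$ and $\gamma'$. In particular (taking $\gamma'=\gamma$), $w\in A^+_{q-\varepsilon}(\gamma)$ with a constant depending only on $n,p,q,\gamma$ and $K$. -/

import Mathlib

open MeasureTheory
open scoped NNReal ENNReal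

namespace ParabolicWeights

/-- The closed cube `Q(x, L)` with center `x` and side length `L`, in the convention
`Q(x, L) = {y : |y i - x i| ≤ L for all i}`. -/
def cube {n : ℕ} (x : Fin n → ℝ) (L : ℝ) : Set (Fin n → ℝ) :=
  {y | ∀ i, |y i - x i| ≤ L}

/-- The upper part `R⁺(γ) = Q(x, L) × (t + γ L ^ p, t + L ^ p)` of the parabolic rectangle
`R(x, t, L) = Q(x, L) × (t - L ^ p, t + L ^ p)`. -/
def upperPart {n : ℕ} (p γ : ℝ) (x : Fin n → ℝ) (t L : ℝ) : Set ((Fin n → ℝ) × ℝ) :=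
  cube x L ×ˢ Set.Ioo (t + γ * L ^ p) (t + L ^ p)

/-- The lower part `R⁻(γ) = Q(x, L) × (t - L ^ p, t - γ L ^ p)` of the parabolic rectangle
`R(x, t, L)`. -/
def lowerPart {n : ℕ} (p γ : ℝ) (x : Fin n → ℝ) (t L : ℝ) : Set ((Fin n → ℝ) × ℝ) :=
  cube x L ×ˢ Set.Ioo (t - L ^ p) (t - γ * L ^ p)

/-- A weight on `ℝⁿ × ℝ` is a locally integrable nonnegative function. -/
structure IsWeight {n : ℕ} (w : (Fin n → ℝ) × ℝ → ℝ) : Prop where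
  nonneg : ∀ z, 0 ≤ w z
  locallyIntegrable : LocallyIntegrable w volume

/-- The constant `[w]` of the class `A_q⁺(γ)` (for `1 < q`), as an extended nonnegative number:
the supremum over all parabolic rectangles `R(x, t, L)`, `L > 0`, of
`(⨍_{R⁻(γ)} w) * (⨍_{R⁺(γ)} w ^ (1 / (1 - q))) ^ (q - 1)`.
The power `w ^ (1 / (1 - q))` is `∞` where `w = 0`, and `0 * ∞ = 0`. -/
noncomputable def aqPlusConst {n : ℕ} (p q γ : ℝ) (w : (Fin n → ℝ) × ℝ → ℝ) : ℝ≥0∞ :=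
  ⨆ (x : Fin n → ℝ) (t : ℝ) (L : ℝ) (_ : 0 < L),
    (⨍⁻ z in lowerPart p γ x t L, ENNReal.ofReal (w z) ∂volume) *
      (⨍⁻ z in upperPart p γ x t L, ENNReal.ofReal (w z) ^ (1 / (1 - q)) ∂volume) ^ (q - 1)

/-- Membership of `w` in the parabolic Muckenhoupt class `A_q⁺(γ)`, `1 < q`, `0 ≤ γ < 1`. -/
structure MemAqPlus {n : ℕ} (p q γ : ℝ) (w : (Fin n → ℝ) × ℝ → ℝ) : Prop where
  isWeight : IsWeight w
  const_lt_top : aqPlusConst p q γ w < ∞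

end ParabolicWeights

/-! Write σ = w^(1/(1-q)) for the dual weight. The improvement comes from a Gehring-type reverse
Hölder inequality for σ, followed by a chaining argument that makes the time lag arbitrary.

If σ is small on a set E in the lower part of a rectangle, compared with its mean over a box in the
upper part, Hölder on E and the `A_q⁺` condition force E to be small. So σ exceeds a multiple of its
mean over a box on a substantial part of an enlarged box (`exists_superlevel_dual_weight`). The
enlarged box absorbs the time lag, and the rest of the reverse Hölder argument is not one-sided:
boxes are balls of a metric with power-law volume, and a Vitali covering at stopping radii,
layer-cake integration and absorption bound ∫ σ^(1+δ) on a ball by its double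
(`reverse_holder_of_superlevel`).

For the lag, w-mass moves forward in time from box to box. A box of radius r moves about r in space
at a cost of about r^p in time; since p > 1, many small steps cross a distance L within any fixed
fraction of L^p (`exists_lintegral_box_mul_le`). Covering both parts of a rectangle by small boxes,
pairing them by chains, and raising the power of σ gives the exponent q - ε = 1 + (q-1)/(1+δ). Only
the chains and the cover depend on γ', so ε does not. -/

section Gehring
open Metric Set Filter Topology

/-! ### Layer-cake integration of a superlevel estimate -/

theorem lintegral_Ioc_rpow {δ l₀ : ℝ} (hδ : 0 < δ) (hl₀ : 0 < l₀) :
    ∫⁻ l in Ioc 0 l₀, ENNReal.ofReal (l ^ (δ - 1)) = ENNReal.ofReal (l₀ ^ δ / δ) := by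
  rw [← ofReal_integral_eq_lintegral_ofReal]
  · rw [← intervalIntegral.integral_of_le hl₀.le, integral_rpow (Or.inl (by linarith))]
    simp [Real.zero_rpow hδ.ne']
  · exact (intervalIntegrable_iff_integrableOn_Ioc_of_le hl₀.le).mp
      (intervalIntegral.intervalIntegrable_rpow' (by linarith))
  · filter_upwards [ae_restrict_mem measurableSet_Ioc] with l hl
    exact Real.rpow_nonneg hl.1.le _

/-- Integrating `H` against δ l^(δ-1) dl turns the superlevel bound into one for the power 1 + δ.
The factor δ in front of the last integral is what later allows absorption; truncation at `k` keeps
that integral finite. -/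
theorem lintegral_mul_truncation_rpow_le {X : Type*} [MeasurableSpace X] {μ : Measure X}
    {v : X → ℝ≥0∞} (hv : Measurable v) {A B : Set X} {C : ℝ≥0∞} (hC : C ≠ ∞)
    {c₁ δ l₀ : ℝ} (hc₁ : 0 < c₁) (hc₁' : c₁ ≤ 1)
    (hδ : 0 < δ) (hδ1 : δ ≤ 1) (hl₀ : 0 < l₀)
    (H : ∀ l : ℝ, l₀ < l → ∫⁻ y in A ∩ {y | ENNReal.ofReal l < v y}, v y ∂μ ≤
      C * (ENNReal.ofReal l * μ (B ∩ {y | ENNReal.ofReal (c₁ * l) < v y}))) (k : ℝ≥0) :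
    ∫⁻ y in A, v y * ENNReal.ofReal ((min (v y) k).toReal ^ δ) ∂μ ≤
      ENNReal.ofReal (l₀ ^ δ) * ∫⁻ y, v y ∂μ + C * ENNReal.ofReal (δ * (c₁ ^ 2)⁻¹) *
        ∫⁻ y in B, v y * ENNReal.ofReal ((min (v y) k).toReal ^ δ) ∂μ := by
  set f : X → ℝ := fun y => (min (v y) k).toReal with hf
  have hfm : Measurable f := (hv.min measurable_const).ennreal_toReal
  have hf0 : ∀ y, 0 ≤ f y := fun y => ENNReal.toReal_nonneg
  have hmintop : ∀ y, min (v y) (k : ℝ≥0∞) ≠ ∞ := fun y =>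
    ((min_le_right _ _).trans_lt ENNReal.coe_lt_top).ne
  have hfv : ∀ y, ENNReal.ofReal (f y) ≤ v y := fun y => by
    rw [hf, ENNReal.ofReal_toReal (hmintop y)]; exact min_le_left _ _
  have hlt : ∀ (l : ℝ) (y : X), 0 < l → (l < f y ↔ ENNReal.ofReal l < v y ∧ l < k) := by
    intro l y hl
    rw [hf, ← ENNReal.ofReal_lt_iff_lt_toReal hl.le (hmintop y), lt_min_iff,
      ENNReal.ofReal_lt_coe_iff hl.le]
  set ν := (μ.restrict A).withDensity v with hν
  have hνset : ∀ S : Set X, MeasurableSet S → ν S = ∫⁻ y in A ∩ S, v y ∂μ := fun S hS => by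
    rw [hν, withDensity_apply _ hS, Measure.restrict_restrict hS, inter_comm]
  have hfδ : Measurable fun y => ENNReal.ofReal (f y ^ δ) := (hfm.pow_const δ).ennreal_ofReal
  have e1 : ∫⁻ y in A, v y * ENNReal.ofReal (f y ^ δ) ∂μ = ∫⁻ y, ENNReal.ofReal (f y ^ δ) ∂ν := by
    rw [hν, lintegral_withDensity_eq_lintegral_mul _ hv hfδ]; rfl
  have hsplit : Ioi (0 : ℝ) = Ioc 0 l₀ ∪ Ioi l₀ := (Ioc_union_Ioi_eq_Ioi hl₀.le).symm
  have e2 : ENNReal.ofReal δ * ∫⁻ l in Ioc 0 l₀, ν {y | l < f y} * ENNReal.ofReal (l ^ (δ - 1)) ≤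
      ENNReal.ofReal (l₀ ^ δ) * ∫⁻ y, v y ∂μ := by
    calc _ ≤ ENNReal.ofReal δ *
          ∫⁻ l in Ioc 0 l₀, (∫⁻ y, v y ∂μ) * ENNReal.ofReal (l ^ (δ - 1)) := by
          gcongr with l
          refine (measure_mono (subset_univ _)).trans ?_
          rw [hνset _ MeasurableSet.univ]
          exact setLIntegral_le_lintegral _ _
      _ = _ := by
          rw [lintegral_const_mul _ (by fun_prop), lintegral_Ioc_rpow hδ hl₀, mul_left_comm,
            ← ENNReal.ofReal_mul hδ.le, mul_div_cancel₀ _ hδ.ne', mul_comm]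
  have hg0 : ∀ y, 0 ≤ f y / c₁ := fun y => div_nonneg (hf0 y) hc₁.le
  have e3 : ENNReal.ofReal δ * ∫⁻ l in Ioi l₀, ν {y | l < f y} * ENNReal.ofReal (l ^ (δ - 1)) ≤
      C * ENNReal.ofReal (δ * (c₁ ^ 2)⁻¹) * ∫⁻ y in B, v y * ENNReal.ofReal (f y ^ δ) ∂μ := by
    calc _ ≤ ENNReal.ofReal δ * ∫⁻ l in Ioi l₀,
          C * ((μ.restrict B) {y | l < f y / c₁} * ENNReal.ofReal (l ^ ((1 + δ) - 1))) := by
          gcongr 1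
          refine setLIntegral_mono' measurableSet_Ioi fun l hl => ?_
          have hl0 : 0 < l := hl₀.trans hl
          have hm : MeasurableSet {y | l < f y} := measurableSet_lt measurable_const hfm
          -- Levels l ≥ k are never exceeded by the truncation. For l < k, also c₁ l < k because c₁
          -- ≤ 1, so truncation changes neither superlevel set.
          by_cases hlk : l < k
          · have h1 : ν {y | l < f y} ≤
                C * (ENNReal.ofReal l * (μ.restrict B) {y | l < f y / c₁}) := by
              rw [hνset _ hm]
              refine (lintegral_mono_set (inter_subset_inter_right A fun y hy =>
                ((hlt l y hl0).mp hy).1)).trans ((H l hl).trans ?_)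
              rw [Measure.restrict_apply (measurableSet_lt measurable_const (hfm.div_const _)),
                inter_comm]
              gcongr C * (_ * ?_)
              refine measure_mono fun y hy => ⟨?_, hy.2⟩
              have hy : ENNReal.ofReal (c₁ * l) < v y := hy.1
              change l < f y / c₁
              rw [lt_div_iff₀ hc₁, mul_comm, hlt _ _ (by positivity)]
              exact ⟨hy, by nlinarith⟩
            calc _ ≤ C * (ENNReal.ofReal l * (μ.restrict B) {y | l < f y / c₁}) *
                  ENNReal.ofReal (l ^ (δ - 1)) := by gcongr
              _ = C * ((μ.restrict B) {y | l < f y / c₁} *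
                  (ENNReal.ofReal l * ENNReal.ofReal (l ^ (δ - 1)))) := by ring
              _ = _ := by
                rw [← ENNReal.ofReal_mul hl0.le, Real.rpow_sub_one hl0.ne', add_sub_cancel_left,
                  mul_div_cancel₀ _ hl0.ne']
          · have : {y | l < f y} = ∅ := by
              ext y; simpa [hlt l y hl0] using fun _ => not_lt.mp hlk
            simp [this]
      _ ≤ ENNReal.ofReal δ * (C * ∫⁻ l in Ioi 0,
          ((μ.restrict B) {y | l < f y / c₁} * ENNReal.ofReal (l ^ ((1 + δ) - 1)))) := by
          rw [← lintegral_const_mul' _ _ hC]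
          gcongr
      _ ≤ ENNReal.ofReal δ * (C * ∫⁻ y in B, ENNReal.ofReal ((f y / c₁) ^ (1 + δ)) ∂μ) := by
          gcongr
          rw [lintegral_rpow_eq_lintegral_meas_lt_mul _ (ae_of_all _ hg0)
            (hfm.div_const _).aemeasurable (by linarith)]
          refine le_mul_of_one_le_left zero_le ?_
          rw [ENNReal.one_le_ofReal]; linarith
      _ ≤ ENNReal.ofReal δ * (C * (ENNReal.ofReal ((c₁ ^ 2)⁻¹) *
          ∫⁻ y in B, v y * ENNReal.ofReal (f y ^ δ) ∂μ)) := by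
          rw [← lintegral_const_mul' _ _ ENNReal.ofReal_ne_top]
          gcongr with y
          calc ENNReal.ofReal ((f y / c₁) ^ (1 + δ))
              ≤ ENNReal.ofReal ((c₁ ^ 2)⁻¹ * (f y * f y ^ δ)) := by
                refine ENNReal.ofReal_le_ofReal ?_
                rw [Real.div_rpow (hf0 y) hc₁.le, div_eq_inv_mul,
                  Real.rpow_one_add' (hf0 y) (by linarith)]
                have : 0 ≤ f y * f y ^ δ := mul_nonneg (hf0 y) (Real.rpow_nonneg (hf0 y) _)
                gcongr
                rw [← Real.rpow_natCast]
                exact Real.rpow_le_rpow_of_exponent_ge hc₁ hc₁' (by push_cast; linarith)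
            _ = ENNReal.ofReal ((c₁ ^ 2)⁻¹) * (ENNReal.ofReal (f y) * ENNReal.ofReal (f y ^ δ)) := by
                rw [ENNReal.ofReal_mul (by positivity), ENNReal.ofReal_mul (hf0 y)]
            _ ≤ _ := by gcongr; exact hfv y
      _ = _ := by rw [ENNReal.ofReal_mul hδ.le]; ring
  calc ∫⁻ y in A, v y * ENNReal.ofReal (f y ^ δ) ∂μ
      = ENNReal.ofReal δ * ∫⁻ l in Ioi 0, ν {y | l < f y} * ENNReal.ofReal (l ^ (δ - 1)) := by
        rw [e1, lintegral_rpow_eq_lintegral_meas_lt_mul _ (ae_of_all _ hf0) hfm.aemeasurable hδ]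
    _ ≤ ENNReal.ofReal δ * ((∫⁻ l in Ioc 0 l₀, ν {y | l < f y} * ENNReal.ofReal (l ^ (δ - 1))) +
        ∫⁻ l in Ioi l₀, ν {y | l < f y} * ENNReal.ofReal (l ^ (δ - 1))) := by
        gcongr
        rw [hsplit]
        exact lintegral_union_le _ _ _
    _ ≤ _ := by rw [mul_add]; exact add_le_add e2 e3

/-! ### Stopping balls and the superlevel estimate -/

variable {X : Type*} [PseudoMetricSpace X] [MeasurableSpace X] {μ : Measure X}

theorem isUnifLocDoublingMeasure_of_measure_closedBall {c D : ℝ}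
    (hμ : ∀ z r, 0 < r → μ (closedBall z r) = ENNReal.ofReal (c * r ^ D)) :
    IsUnifLocDoublingMeasure μ := by
  refine ⟨⟨(2 ^ D : ℝ).toNNReal, ?_⟩⟩
  filter_upwards [self_mem_nhdsWithin] with ε hε z
  have hε : 0 < ε := hε
  rw [hμ z _ hε, hμ z _ (by positivity), Real.mul_rpow (by norm_num) hε.le]
  change _ ≤ ENNReal.ofReal (2 ^ D) * _
  rw [← ENNReal.ofReal_mul (by positivity)]
  exact ENNReal.ofReal_le_ofReal (le_of_eq (by ring))

theorem isLocallyFiniteMeasure_of_measure_closedBall {c D : ℝ}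
    (hμ : ∀ z r, 0 < r → μ (closedBall z r) = ENNReal.ofReal (c * r ^ D)) :
    IsLocallyFiniteMeasure μ :=
  ⟨fun z => ⟨closedBall z 1, closedBall_mem_nhds z one_pos, by simp [hμ z 1 one_pos]⟩⟩

/-- The last radius at which the mean value of `v` over a ball around `z` exceeds `l`, up to a
factor `2`. -/
theorem exists_stopping_radius {c D : ℝ} (hc : 0 < c) (hD : 0 < D)
    (hμ : ∀ z r, 0 < r → μ (closedBall z r) = ENNReal.ofReal (c * r ^ D))
    {v : X → ℝ≥0∞} {z : X} {l : ℝ≥0∞} {d κ : ℝ} (hd : 0 < d) (hκ : 1 ≤ κ)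
    (hz : Tendsto (fun r : ℝ => (∫⁻ y in closedBall z r, v y ∂μ) / μ (closedBall z r))
      (𝓝[>] 0) (𝓝 (v z)))
    (hlz : l < v z)
    (hl : (∫⁻ y, v y ∂μ) / ENNReal.ofReal (c * (d / (5 * κ)) ^ D) ≤ l) :
    ∃ ρ : ℝ, 0 < ρ ∧ 5 * κ * ρ < d ∧
      l < (∫⁻ y in closedBall z ρ, v y ∂μ) / μ (closedBall z ρ) ∧
      ∫⁻ y in closedBall z (5 * κ * ρ), v y ∂μ ≤ l * μ (closedBall z (5 * κ * ρ)) := by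
  set S : Set ℝ := {ρ | 0 < ρ ∧ ρ ≤ d ∧
    l < (∫⁻ y in closedBall z ρ, v y ∂μ) / μ (closedBall z ρ)} with hS
  have hne : S.Nonempty := by
    have h1 := hz.eventually (lt_mem_nhds hlz)
    have h2 : ∀ᶠ r : ℝ in 𝓝[>] 0, r ∈ Ioo 0 d := Ioo_mem_nhdsGT hd
    obtain ⟨r, hr1, hr2⟩ := (h1.and h2).exists
    exact ⟨r, hr2.1, hr2.2.le, hr1⟩
  have hbdd : BddAbove S := ⟨d, fun ρ h => h.2.1⟩
  have hspos : 0 < sSup S := by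
    obtain ⟨r, hr⟩ := hne
    exact hr.1.trans_le (le_csSup hbdd hr)
  -- Beyond half the supremum suffices: 5κρ then exceeds the supremum, so the mean over the enlarged
  -- ball is at most l.
  obtain ⟨ρ, hρ, hρs⟩ := exists_lt_of_lt_csSup hne (half_lt_self hspos)
  have hρ0 : 0 < ρ := hρ.1
  have hsmall : 5 * κ * ρ < d := by
    by_contra hcon
    push Not at hcon
    have h5 : d / (5 * κ) ≤ ρ := by
      rw [div_le_iff₀ (by positivity)]; linarith
    refine absurd hρ.2.2 (not_lt.mpr (le_trans ?_ hl))
    rw [hμ z ρ hρ0]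
    refine ENNReal.div_le_div (setLIntegral_le_lintegral _ _) (ENNReal.ofReal_le_ofReal ?_)
    have : 0 < d / (5 * κ) := by positivity
    gcongr
  refine ⟨ρ, hρ0, hsmall, hρ.2.2, ?_⟩
  have h5pos : 0 < 5 * κ * ρ := by positivity
  have hnot : 5 * κ * ρ ∉ S := fun h => by
    have := le_csSup hbdd h
    nlinarith
  have h : (∫⁻ y in closedBall z (5 * κ * ρ), v y ∂μ) / μ (closedBall z (5 * κ * ρ)) ≤ l := by
    by_contra hcon
    exact hnot ⟨h5pos, hsmall.le, not_le.mp hcon⟩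
  have hm : 0 < c * (5 * κ * ρ) ^ D := by positivity
  rwa [ENNReal.div_le_iff_le_mul (Or.inl ?_) (Or.inl ?_)] at h
  · rw [hμ z _ h5pos]; simpa using hm
  · rw [hμ z _ h5pos]; simp

variable [BorelSpace X] [SecondCountableTopology X]

theorem ae_tendsto_setLAverage_closedBall {c D : ℝ}
    (hμ : ∀ z r, 0 < r → μ (closedBall z r) = ENNReal.ofReal (c * r ^ D))
    {v : X → ℝ≥0∞} (hv : AEMeasurable v μ) (hvI : ∫⁻ y, v y ∂μ ≠ ∞) :
    ∀ᵐ z ∂μ, Tendsto (fun r : ℝ => (∫⁻ y in closedBall z r, v y ∂μ) / μ (closedBall z r))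
      (𝓝[>] 0) (𝓝 (v z)) := by
  have := isUnifLocDoublingMeasure_of_measure_closedBall hμ
  have := isLocallyFiniteMeasure_of_measure_closedBall hμ
  filter_upwards [(IsUnifLocDoublingMeasure.vitaliFamily μ 1).ae_tendsto_lintegral_div hv hvI]
    with z hz
  exact hz.comp (IsUnifLocDoublingMeasure.tendsto_closedBall_filterAt μ (fun _ => z) id
    tendsto_id (by filter_upwards [self_mem_nhdsWithin] with r hr
                   simpa using (le_of_lt hr)))

/-- Almost every point of the superlevel set is the centre of a stopping ball. The balls of radius
κρ, where `H` finds large values of v, are selected disjoint; their 5-fold enlargements cover and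
have mean at most l. Since κρ < r - s, the selected balls stay in the ball of radius r. -/
theorem setLIntegral_superlevel_le {c D : ℝ} (hc : 0 < c) (hD : 0 < D)
    (hμ : ∀ z r, 0 < r → μ (closedBall z r) = ENNReal.ofReal (c * r ^ D))
    {v : X → ℝ≥0∞} (hv : Measurable v) (hvI : ∫⁻ y, v y ∂μ ≠ ∞)
    {z₀ : X} {R κ : ℝ} (hκ : 1 ≤ κ) {c₁ c₂ : ℝ≥0} (hc₂ : c₂ ≠ 0)
    (H : ∀ z r, 0 < r → closedBall z (κ * r) ⊆ closedBall z₀ R →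
      c₂ * μ (closedBall z r) ≤ μ (closedBall z (κ * r) ∩
        {y | c₁ * ((∫⁻ y in closedBall z r, v y ∂μ) / μ (closedBall z r)) < v y}))
    {s r : ℝ} (hsr : s < r) (hrR : r ≤ R) {l : ℝ≥0∞}
    (hl : (∫⁻ y, v y ∂μ) / ENNReal.ofReal (c * ((r - s) / (5 * κ)) ^ D) ≤ l) :
    ∫⁻ y in closedBall z₀ s ∩ {y | l < v y}, v y ∂μ ≤
      ENNReal.ofReal ((5 * κ) ^ D) / c₂ * (l * μ (closedBall z₀ r ∩ {y | c₁ * l < v y})) := by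
  have hd : 0 < r - s := sub_pos.mpr hsr
  set Z : Set X := {z | z ∈ closedBall z₀ s ∧ l < v z ∧
    Tendsto (fun r : ℝ => (∫⁻ y in closedBall z r, v y ∂μ) / μ (closedBall z r))
      (𝓝[>] 0) (𝓝 (v z))} with hZ
  have hrad : ∀ z : X, ∃ ρ : ℝ, z ∈ Z → 0 < ρ ∧ 5 * κ * ρ < r - s ∧
      l < (∫⁻ y in closedBall z ρ, v y ∂μ) / μ (closedBall z ρ) ∧
      ∫⁻ y in closedBall z (5 * κ * ρ), v y ∂μ ≤ l * μ (closedBall z (5 * κ * ρ)) := by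
    intro z
    by_cases hz : z ∈ Z
    · obtain ⟨ρ, h⟩ := exists_stopping_radius hc hD hμ hd hκ hz.2.2 hz.2.1 hl
      exact ⟨ρ, fun _ => h⟩
    · exact ⟨0, fun h => absurd h hz⟩
  choose ρ hρ using hrad
  obtain ⟨u, huZ, hdisj, hcov⟩ := Vitali.exists_disjoint_subfamily_covering_enlargement_closedBall
    Z id (fun z => κ * ρ z) (r - s)
    (fun z hz => by
      have h := hρ z hz
      have : 0 < κ * ρ z := mul_pos (by linarith) h.1
      linarith [h.2.1]) 5 (by norm_num)
  have hucount : u.Countable := by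
    refine hdisj.countable_of_nonempty_interior fun z hz => ⟨z, ?_⟩
    have h := (hρ z (huZ hz)).1
    exact ball_subset_interior_closedBall (mem_ball_self (mul_pos (by linarith) h))
  have : Countable u := hucount.to_subtype
  have hsub : ∀ z ∈ u, closedBall z (κ * ρ z) ⊆ closedBall z₀ r := fun z hz => by
    have h := hρ z (huZ hz)
    have h0 : 0 < κ * ρ z := mul_pos (by linarith) h.1
    refine closedBall_subset_closedBall' ?_
    have := mem_closedBall.mp (huZ hz).1
    linarith [h.2.1]
  have hterm : ∀ z : u, ∫⁻ y in closedBall (z : X) (5 * (κ * ρ z)), v y ∂μ ≤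
      ENNReal.ofReal ((5 * κ) ^ D) / c₂ *
        (l * μ (closedBall (z : X) (κ * ρ z) ∩ {y | c₁ * l < v y})) := by
    intro z
    have h := hρ z (huZ z.2)
    have h5 : 0 < 5 * κ * ρ z := by have := h.1; positivity
    have h1 : c₂ * μ (closedBall (z : X) (ρ z)) ≤
        μ (closedBall (z : X) (κ * ρ z) ∩ {y | c₁ * l < v y}) := by
      refine (H z (ρ z) h.1 ((hsub z z.2).trans (closedBall_subset_closedBall hrR))).trans ?_
      refine measure_mono (inter_subset_inter_right _ fun y hy => ?_)
      refine lt_of_le_of_lt (b := c₁ * ((∫⁻ y in closedBall (z : X) (ρ z), v y ∂μ) /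
        μ (closedBall (z : X) (ρ z)))) ?_ hy
      gcongr
      exact h.2.2.1.le
    have h2 : μ (closedBall (z : X) (ρ z)) ≤
        μ (closedBall (z : X) (κ * ρ z) ∩ {y | c₁ * l < v y}) / c₂ := by
      rw [ENNReal.le_div_iff_mul_le (Or.inl (by simpa using hc₂)) (Or.inl (by simp)), mul_comm]
      exact h1
    calc ∫⁻ y in closedBall (z : X) (5 * (κ * ρ z)), v y ∂μ
        ≤ l * μ (closedBall (z : X) (5 * κ * ρ z)) := by rw [← mul_assoc]; exact h.2.2.2
      _ = l * (ENNReal.ofReal ((5 * κ) ^ D) * μ (closedBall (z : X) (ρ z))) := by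
          rw [hμ _ _ h5, hμ _ _ h.1, Real.mul_rpow (by positivity) h.1.le,
            ← ENNReal.ofReal_mul (by positivity)]
          ring_nf
      _ ≤ l * (ENNReal.ofReal ((5 * κ) ^ D) *
            (μ (closedBall (z : X) (κ * ρ z) ∩ {y | c₁ * l < v y}) / c₂)) := by gcongr
      _ = _ := by simp only [div_eq_mul_inv]; ring
  calc ∫⁻ y in closedBall z₀ s ∩ {y | l < v y}, v y ∂μ
      ≤ ∫⁻ y in ⋃ z : u, closedBall (z : X) (5 * (κ * ρ z)), v y ∂μ := by
        refine lintegral_mono_set' ?_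
        filter_upwards [ae_tendsto_setLAverage_closedBall hμ hv.aemeasurable hvI] with z hz hzs
        have hzZ : z ∈ Z := ⟨hzs.1, hzs.2, hz⟩
        obtain ⟨b, hb, hzb⟩ := hcov z hzZ
        refine mem_iUnion.mpr ⟨⟨b, hb⟩, hzb (mem_closedBall_self ?_)⟩
        exact (mul_pos (by linarith) (hρ z hzZ).1).le
    _ ≤ ∑' z : u, ∫⁻ y in closedBall (z : X) (5 * (κ * ρ z)), v y ∂μ :=
        lintegral_iUnion_le _ _
    _ ≤ ∑' z : u, ENNReal.ofReal ((5 * κ) ^ D) / c₂ *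
        (l * μ (closedBall (z : X) (κ * ρ z) ∩ {y | c₁ * l < v y})) :=
        ENNReal.tsum_le_tsum hterm
    _ = ENNReal.ofReal ((5 * κ) ^ D) / c₂ * (l *
        μ (⋃ z : u, (closedBall (z : X) (κ * ρ z) ∩ {y | c₁ * l < v y}))) := by
        rw [ENNReal.tsum_mul_left, ENNReal.tsum_mul_left, measure_iUnion]
        · intro a b hab
          exact (hdisj a.2 b.2 (fun h => hab (Subtype.ext h))).mono inter_subset_left
            inter_subset_left
        · intro z
          exact isClosed_closedBall.measurableSet.inter (measurableSet_lt measurable_const hv)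
    _ ≤ _ := by
        gcongr
        exact iUnion_subset fun z => inter_subset_inter_left _ (hsub z z.2)

/-! ### Absorption and the reverse Hölder inequality -/

/-- The supremum S of d^(-j) a_j satisfies S ≤ A + S/2. The uniform bound M makes S finite, so the
last term can be absorbed. -/
theorem le_two_mul_of_le_add_mul_succ {a : ℕ → ℝ≥0∞} {A M d θ : ℝ≥0∞} (hd : 1 ≤ d) (hd' : d ≠ ∞)
    (hM : M ≠ ∞) (haM : ∀ j, a j ≤ M) (hθ : θ * d ≤ 2⁻¹)
    (h : ∀ j, a j ≤ d ^ j * A + θ * a (j + 1)) : a 0 ≤ 2 * A := by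
  have hd0 : d ≠ 0 := (zero_lt_one.trans_le hd).ne'
  set S : ℝ≥0∞ := ⨆ j, (d ^ j)⁻¹ * a j with hS
  have hSM : S ≤ M := iSup_le fun j => by
    calc (d ^ j)⁻¹ * a j ≤ 1 * M := by
          gcongr
          · exact ENNReal.inv_le_one.mpr (one_le_pow₀ hd)
          · exact haM j
      _ = M := one_mul M
  have hS' : S ≤ A + 2⁻¹ * S := by
    refine iSup_le fun j => ?_
    have hj0 : d ^ j ≠ 0 := pow_ne_zero _ hd0
    have hjt : d ^ j ≠ ∞ := ENNReal.pow_ne_top hd'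
    calc (d ^ j)⁻¹ * a j ≤ (d ^ j)⁻¹ * (d ^ j * A + θ * a (j + 1)) := by gcongr; exact h j
      _ = A + θ * d * ((d ^ (j + 1))⁻¹ * a (j + 1)) := by
          rw [mul_add, ← mul_assoc, ENNReal.inv_mul_cancel hj0 hjt, one_mul, pow_succ,
            ENNReal.mul_inv (Or.inl hj0) (Or.inl hjt)]
          congr 1
          calc (d ^ j)⁻¹ * (θ * a (j + 1)) = (d ^ j)⁻¹ * (θ * a (j + 1)) * (d * d⁻¹) := by
                rw [ENNReal.mul_inv_cancel hd0 hd', mul_one]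
            _ = _ := by ring
      _ ≤ A + 2⁻¹ * S := by gcongr; exact le_iSup (fun j => (d ^ j)⁻¹ * a j) (j + 1)
  have hStop : S ≠ ∞ := (hSM.trans_lt hM.lt_top).ne
  have h0 : a 0 ≤ S := by simpa using le_iSup (fun j => (d ^ j)⁻¹ * a j) 0
  refine h0.trans ?_
  rcases eq_or_ne A ∞ with rfl | hA
  · simp
  have hr : S.toReal ≤ A.toReal + 2⁻¹ * S.toReal := by
    have := ENNReal.toReal_mono (by finiteness) hS'
    rwa [ENNReal.toReal_add hA (by finiteness), ENNReal.toReal_mul, ENNReal.toReal_inv,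
      ENNReal.toReal_ofNat] at this
  rw [← ENNReal.ofReal_toReal hStop, ← ENNReal.ofReal_toReal hA,
    ← ENNReal.ofReal_ofNat 2, ← ENNReal.ofReal_mul (by norm_num)]
  exact ENNReal.ofReal_le_ofReal (by linarith)

theorem tendsto_mul_truncation_rpow (x : ℝ≥0∞) {δ : ℝ} (hδ : 0 < δ) :
    Tendsto (fun k : ℕ => x * ENNReal.ofReal ((min x (k : ℝ≥0)).toReal ^ δ)) atTop
      (𝓝 (x ^ (1 + δ))) := by
  have h1 : ∀ k : ℕ, ENNReal.ofReal ((min x ((k : ℝ≥0) : ℝ≥0∞)).toReal ^ δ) =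
      (min x ((k : ℝ≥0) : ℝ≥0∞)) ^ δ := fun k => by
    have : min x ((k : ℝ≥0) : ℝ≥0∞) ≠ ∞ := ((min_le_right _ _).trans_lt ENNReal.coe_lt_top).ne
    rw [← ENNReal.ofReal_rpow_of_nonneg ENNReal.toReal_nonneg hδ.le, ENNReal.ofReal_toReal this]
  simp only [h1]
  have h2 : Tendsto (fun k : ℕ => min x ((k : ℝ≥0) : ℝ≥0∞)) atTop (𝓝 x) := by
    have := (tendsto_const_nhds (x := x)).min ENNReal.tendsto_nat_nhds_top
    simpa using this
  have h3 := (ENNReal.continuous_rpow_const (y := δ)).continuousAt.tendsto.comp h2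
  have h4 : x ^ (1 + δ) = x * x ^ δ := by
    rw [ENNReal.rpow_add_of_nonneg _ _ zero_le_one hδ.le, ENNReal.rpow_one]
  rw [h4]
  refine ENNReal.Tendsto.const_mul h3 ?_
  rcases eq_or_ne x ∞ with rfl | hx
  · left; simp [hδ]
  · exact Or.inr hx

/-- Radii increasing from R to 2R link the truncated integrals over successive balls. The gaps
shrink like 2^(-j), so the admissible levels grow like 2^(Dj); a small δ beats this growth, and
monotone convergence removes the truncation. -/
theorem reverse_holder_of_superlevel {c D : ℝ} (hc : 0 < c) (hD : 0 < D)
    (hμ : ∀ z r, 0 < r → μ (closedBall z r) = ENNReal.ofReal (c * r ^ D))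
    {κ : ℝ} (hκ : 1 ≤ κ) {c₁ c₂ : ℝ≥0} (hc₁ : c₁ ≠ 0) (hc₁' : c₁ ≤ 1) (hc₂ : c₂ ≠ 0) :
    ∃ δ : ℝ, 0 < δ ∧ ∃ C : ℝ≥0, ∀ (v : X → ℝ≥0∞), Measurable v → ∀ (z₀ : X) (R : ℝ), 0 < R →
      ∫⁻ y in closedBall z₀ (2 * R), v y ∂μ ≠ ∞ →
      (∀ z r, 0 < r → closedBall z (κ * r) ⊆ closedBall z₀ (2 * R) →
        c₂ * μ (closedBall z r) ≤ μ (closedBall z (κ * r) ∩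
          {y | c₁ * ((∫⁻ y in closedBall z r, v y ∂μ) / μ (closedBall z r)) < v y})) →
      ∫⁻ y in closedBall z₀ R, v y ^ (1 + δ) ∂μ ≤
        C * (∫⁻ y in closedBall z₀ (2 * R), v y ∂μ) *
          ((∫⁻ y in closedBall z₀ (2 * R), v y ∂μ) / μ (closedBall z₀ (2 * R))) ^ δ := by
  set C₃ : ℝ≥0∞ := ENNReal.ofReal ((5 * κ) ^ D) / c₂ with hC₃
  have hC₃t : C₃ ≠ ∞ := ENNReal.div_ne_top ENNReal.ofReal_ne_top (by simpa using hc₂)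
  have hc₁p : (0 : ℝ) < c₁ := by positivity
  set B : ℝ := C₃.toReal * ((c₁ : ℝ) ^ 2)⁻¹ with hB
  have hB0 : 0 ≤ B := by positivity
  -- Chosen so that the absorption factor times the growth 2^D is at most 1/2.
  set δ : ℝ := min 1 ((2 * 2 ^ D * (B + 1))⁻¹) with hδdef
  have h2D : (0 : ℝ) < 2 ^ D := by positivity
  have hδ : 0 < δ := lt_min one_pos (by positivity)
  have hδ1 : δ ≤ 1 := min_le_left _ _
  have hθ : C₃ * ENNReal.ofReal (δ * ((c₁ : ℝ) ^ 2)⁻¹) * ENNReal.ofReal (2 ^ D) ≤ 2⁻¹ := by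
    have e : C₃ * ENNReal.ofReal (δ * ((c₁ : ℝ) ^ 2)⁻¹) * ENNReal.ofReal (2 ^ D) =
        ENNReal.ofReal (B * δ * 2 ^ D) := by
      rw [← ENNReal.ofReal_toReal hC₃t, ← ENNReal.ofReal_mul (by positivity),
        ← ENNReal.ofReal_mul (by positivity), hB]
      ring_nf
    rw [e, ← ENNReal.ofReal_ofNat 2, ← ENNReal.ofReal_inv_of_pos (by norm_num)]
    refine ENNReal.ofReal_le_ofReal ?_
    calc B * δ * 2 ^ D ≤ (B + 1) * (2 * 2 ^ D * (B + 1))⁻¹ * 2 ^ D := by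
          gcongr
          · linarith
          · exact min_le_right _ _
      _ = 2⁻¹ := by field_simp
  refine ⟨δ, hδ, 2 * (((20 * κ) ^ D) ^ δ).toNNReal, fun v₀ hv₀ z₀ R hR hI₀ H₀ => ?_⟩
  set I : ℝ≥0∞ := ∫⁻ y in closedBall z₀ (2 * R), v₀ y ∂μ with hI
  set v : X → ℝ≥0∞ := (closedBall z₀ (2 * R)).indicator v₀ with hvdef
  have hv : Measurable v := hv₀.indicator isClosed_closedBall.measurableSet
  have hvI : ∫⁻ y, v y ∂μ = I := lintegral_indicator isClosed_closedBall.measurableSet _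
  have hvS : ∀ S ⊆ closedBall z₀ (2 * R), ∀ y ∈ S, v y = v₀ y := fun S hS y hy =>
    indicator_of_mem (hS hy) _
  have hRsub : closedBall z₀ R ⊆ closedBall z₀ (2 * R) :=
    closedBall_subset_closedBall (by linarith)
  have hgoal : ∫⁻ y in closedBall z₀ R, v₀ y ^ (1 + δ) ∂μ =
      ∫⁻ y in closedBall z₀ R, v y ^ (1 + δ) ∂μ :=
    setLIntegral_congr_fun isClosed_closedBall.measurableSet fun y hy => by
      simp only [hvS _ hRsub y hy]
  rw [hgoal]
  have H : ∀ z r, 0 < r → closedBall z (κ * r) ⊆ closedBall z₀ (2 * R) →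
      c₂ * μ (closedBall z r) ≤ μ (closedBall z (κ * r) ∩
        {y | c₁ * ((∫⁻ y in closedBall z r, v y ∂μ) / μ (closedBall z r)) < v y}) := by
    intro z r hr hsub
    have hsub' : closedBall z r ⊆ closedBall z₀ (2 * R) :=
      (closedBall_subset_closedBall (by nlinarith)).trans hsub
    rw [setLIntegral_congr_fun isClosed_closedBall.measurableSet (hvS _ hsub')]
    refine (H₀ z r hr hsub).trans (measure_mono fun y hy => ⟨hy.1, ?_⟩)
    change _ < v y
    rw [hvS _ hsub y hy.1]
    exact hy.2
  rcases eq_or_ne I 0 with hI0 | hI0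
  · have : ∫⁻ y in closedBall z₀ R, v y ^ (1 + δ) ∂μ = 0 := by
      rw [← hvI, lintegral_eq_zero_iff hv] at hI0
      refine (lintegral_congr_ae (ae_restrict_of_ae ?_)).trans lintegral_zero
      filter_upwards [hI0] with y hy
      rw [hy]
      exact ENNReal.zero_rpow_of_pos (by linarith)
    rw [this]; exact zero_le
  have hIpos : 0 < I.toReal := ENNReal.toReal_pos hI0 hI₀
  -- The lowest level admissible at step 0. The gap at step j is R 2^(-j-1), so 2R is 20κ 2^j times
  -- the gap divided by 5κ.
  set Λ : ℝ := I.toReal / (c * (2 * R) ^ D) * (20 * κ) ^ D with hΛ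
  have hκ0 : 0 < κ := by linarith
  have hΛ0 : 0 < Λ := by positivity
  set s : ℕ → ℝ := fun j => 2 * R - R * (2⁻¹) ^ j with hs
  have hs0 : s 0 = R := by simp only [hs, pow_zero]; ring
  have hss : ∀ j, s (j + 1) - s j = R * 2⁻¹ * (2⁻¹) ^ j := fun j => by
    simp only [hs, pow_succ]; ring
  have hslt : ∀ j, s j < s (j + 1) := fun j => by
    have : 0 < s (j + 1) - s j := by rw [hss]; positivity
    linarith
  have hs2 : ∀ j, s j ≤ 2 * R := fun j => by
    have : 0 < R * (2⁻¹ : ℝ) ^ j := by positivity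
    simp only [hs]; linarith
  have hlam : ∀ j, I / ENNReal.ofReal (c * ((s (j + 1) - s j) / (5 * κ)) ^ D) =
      ENNReal.ofReal (Λ * (2 ^ D) ^ j) := by
    intro j
    have h0 : 0 < (s (j + 1) - s j) / (5 * κ) := div_pos (sub_pos.mpr (hslt j)) (by positivity)
    rw [← ENNReal.ofReal_toReal hI₀, ← ENNReal.ofReal_div_of_pos (by positivity)]
    congr 1
    have e : 2 * R = (s (j + 1) - s j) / (5 * κ) * (20 * κ) * 2 ^ j := by
      rw [hss, inv_pow]; field_simp; ring
    rw [hΛ, e, Real.mul_rpow (by positivity) (by positivity),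
      Real.mul_rpow (by positivity) (by positivity), ← Real.rpow_natCast 2 j,
      ← Real.rpow_natCast (2 ^ D) j, ← Real.rpow_mul (by norm_num), ← Real.rpow_mul (by norm_num),
      mul_comm (j : ℝ) D]
    have : (0 : ℝ) < 2 ^ (D * j) := by positivity
    field_simp
  have key : ∀ k : ℝ≥0,
      ∫⁻ y in closedBall z₀ R, v y * ENNReal.ofReal ((min (v y) k).toReal ^ δ) ∂μ ≤
        2 * (ENNReal.ofReal (Λ ^ δ) * I) := by
    intro k
    have hstep := le_two_mul_of_le_add_mul_succ
      (a := fun j => ∫⁻ y in closedBall z₀ (s j),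
        v y * ENNReal.ofReal ((min (v y) k).toReal ^ δ) ∂μ)
      (A := ENNReal.ofReal (Λ ^ δ) * I) (M := I * ENNReal.ofReal (k ^ δ))
      (d := ENNReal.ofReal (2 ^ D)) (θ := C₃ * ENNReal.ofReal (δ * ((c₁ : ℝ) ^ 2)⁻¹))
      (by rw [ENNReal.one_le_ofReal]; exact Real.one_le_rpow (by norm_num) hD.le)
      ENNReal.ofReal_ne_top (ENNReal.mul_ne_top hI₀ ENNReal.ofReal_ne_top) ?_ hθ ?_
    · simpa only [hs0] using hstep
    · intro j
      refine (setLIntegral_le_lintegral _ _).trans ?_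
      rw [← hvI, ← lintegral_mul_const _ hv]
      gcongr with y
      have := ENNReal.toReal_mono ENNReal.coe_ne_top (min_le_right (v y) (k : ℝ≥0∞))
      simpa using this
    · intro j
      have hΛj : 0 < Λ * (2 ^ D) ^ j := by positivity
      refine (lintegral_mul_truncation_rpow_le hv (A := closedBall z₀ (s j))
        (B := closedBall z₀ (s (j + 1))) hC₃t hc₁p hc₁' hδ hδ1 hΛj ?_ k).trans ?_
      · intro l hl
        have := setLIntegral_superlevel_le hc hD hμ hv (by rw [hvI]; exact hI₀) hκ hc₂ H
          (hslt j) (hs2 (j + 1)) (l := ENNReal.ofReal l)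
          (by rw [hvI, hlam]; exact ENNReal.ofReal_le_ofReal hl.le)
        simpa only [ENNReal.ofReal_mul hc₁p.le, ENNReal.ofReal_coe_nnreal] using this
      · rw [hvI, ← mul_assoc (ENNReal.ofReal (2 ^ D) ^ j)]
        gcongr ?_ * _ + _
        rw [← ENNReal.ofReal_pow h2D.le, ← ENNReal.ofReal_mul (by positivity),
          Real.mul_rpow hΛ0.le (by positivity), mul_comm (Λ ^ δ)]
        gcongr
        calc ((2 ^ D) ^ j : ℝ) ^ δ ≤ ((2 ^ D) ^ j : ℝ) ^ (1 : ℝ) :=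
              Real.rpow_le_rpow_of_exponent_le
                (one_le_pow₀ (Real.one_le_rpow (by norm_num) hD.le)) hδ1
          _ = _ := Real.rpow_one _
  have hlim : ∫⁻ y in closedBall z₀ R, v y ^ (1 + δ) ∂μ ≤ 2 * (ENNReal.ofReal (Λ ^ δ) * I) := by
    refine le_of_tendsto' (lintegral_tendsto_of_tendsto_of_monotone (fun k => ?_) ?_ ?_)
      fun k : ℕ => key (k : ℝ≥0)
    · exact (hv.mul
        ((hv.min measurable_const).ennreal_toReal.pow_const δ).ennreal_ofReal).aemeasurable
    · refine ae_of_all _ fun y a b hab => ?_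
      dsimp only
      gcongr
      exact ((min_le_right _ _).trans_lt ENNReal.coe_lt_top).ne
    · exact ae_of_all _ fun y => tendsto_mul_truncation_rpow (v y) hδ
  refine hlim.trans (le_of_eq ?_)
  have e : ENNReal.ofReal (Λ ^ δ) = ENNReal.ofReal (((20 * κ) ^ D) ^ δ) *
      (I / μ (closedBall z₀ (2 * R))) ^ δ := by
    rw [hμ _ _ (by positivity), hΛ, Real.mul_rpow (by positivity) (by positivity),
      ENNReal.ofReal_mul (by positivity), mul_comm,
      ← ENNReal.ofReal_rpow_of_nonneg (x := I.toReal / _) (by positivity) hδ.le,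
      ENNReal.ofReal_div_of_pos (by positivity), ENNReal.ofReal_toReal hI₀]
  rw [e]
  push_cast
  change _ = 2 * ENNReal.ofReal (((20 * κ) ^ D) ^ δ) * I * _
  ring

end Gehring

/-! ### Parabolic boxes as metric balls -/

namespace ParabolicWeights
open Metric Set

/-- The closed ball of radius `r` around `z` for the parabolic distance
`max ‖x - y‖∞ (|t - s| ^ (1 / p))`. -/
def box {n : ℕ} (p : ℝ) (z : (Fin n → ℝ) × ℝ) (r : ℝ) : Set ((Fin n → ℝ) × ℝ) :=
  cube z.1 r ×ˢ Icc (z.2 - r ^ p) (z.2 + r ^ p)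

theorem cube_eq_Icc {n : ℕ} (x : Fin n → ℝ) (L : ℝ) :
    cube x L = Icc (fun i => x i - L) (fun i => x i + L) := by
  ext y
  simp only [cube, mem_ofPred_eq, mem_Icc, Pi.le_def, abs_le]
  exact ⟨fun h => ⟨fun i => by linarith [(h i).1], fun i => by linarith [(h i).2]⟩,
    fun h i => ⟨by linarith [h.1 i], by linarith [h.2 i]⟩⟩

theorem cube_eq_closedBall {n : ℕ} (x : Fin n → ℝ) {L : ℝ} (hL : 0 ≤ L) :
    cube x L = closedBall x L := by
  ext y
  simp [cube, mem_closedBall, dist_pi_le_iff hL, Real.dist_eq]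

theorem measurableSet_cube {n : ℕ} (x : Fin n → ℝ) (L : ℝ) : MeasurableSet (cube x L) := by
  rw [cube_eq_Icc]; exact measurableSet_Icc

theorem volume_cube {n : ℕ} (x : Fin n → ℝ) {L : ℝ} (hL : 0 ≤ L) :
    volume (cube x L) = ENNReal.ofReal ((2 * L) ^ n) := by
  rw [cube_eq_closedBall x hL, Real.volume_pi_closedBall x hL, Fintype.card_fin]

theorem volume_box {n : ℕ} (p : ℝ) (z : (Fin n → ℝ) × ℝ) {r : ℝ} (hr : 0 < r) :
    volume (box p z r) = ENNReal.ofReal (2 ^ (n + 1) * r ^ (n + p)) := by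
  rw [box, Measure.volume_eq_prod, Measure.prod_prod, volume_cube _ hr.le, Real.volume_Icc,
    ← ENNReal.ofReal_mul (by positivity), Real.rpow_add hr, Real.rpow_natCast]
  congr 1
  ring

section Snowflake

variable {n : ℕ} {p : ℝ} {h₀ : 0 < p⁻¹} {h₁ : p⁻¹ ≤ 1}

noncomputable instance : MeasurableSpace (Snowflaking ℝ p⁻¹ h₀ h₁) := borel _
instance : BorelSpace (Snowflaking ℝ p⁻¹ h₀ h₁) := ⟨rfl⟩

/-- The identity map from `ℝⁿ × ℝ` to the same set with the parabolic distance. -/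
noncomputable def toParabolic (n : ℕ) (h₀ : 0 < p⁻¹) (h₁ : p⁻¹ ≤ 1) :
    (Fin n → ℝ) × ℝ ≃ᵐ (Fin n → ℝ) × Snowflaking ℝ p⁻¹ h₀ h₁ :=
  ((Homeomorph.refl _).prodCongr Snowflaking.homeomorph.symm).toMeasurableEquiv

theorem preimage_toParabolic_closedBall (hp : 0 < p) (z : (Fin n → ℝ) × ℝ) {r : ℝ} (hr : 0 ≤ r) :
    toParabolic n h₀ h₁ ⁻¹' closedBall (toParabolic n h₀ h₁ z) r = box p z r := by
  ext y
  change dist y.1 z.1 ⊔ |y.2 - z.2| ^ p⁻¹ ≤ r ↔ y.1 ∈ cube z.1 r ∧ y.2 ∈ Icc _ _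
  rw [cube_eq_closedBall _ hr, sup_le_iff, mem_closedBall,
    Real.rpow_inv_le_iff_of_pos (abs_nonneg _) hr hp, abs_le, mem_Icc]
  refine and_congr_right fun _ => ⟨fun h => ⟨by linarith, by linarith⟩,
    fun h => ⟨by linarith, by linarith⟩⟩

end Snowflake

/-- Since 1/p ≤ 1, |t - s|^(1/p) is a metric on the time axis. In the product metric boxes are
closed balls, and Lebesgue measure has dimension D = n + p. -/
theorem reverse_holder_box (n : ℕ) {p : ℝ} (hp : 1 < p) {κ : ℝ} (hκ : 1 ≤ κ) {c₁ c₂ : ℝ≥0}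
    (hc₁ : c₁ ≠ 0) (hc₁' : c₁ ≤ 1) (hc₂ : c₂ ≠ 0) :
    ∃ δ : ℝ, 0 < δ ∧ ∃ C : ℝ≥0, ∀ (v : (Fin n → ℝ) × ℝ → ℝ≥0∞), Measurable v →
      ∀ (z₀ : (Fin n → ℝ) × ℝ) (R : ℝ), 0 < R → ∫⁻ y in box p z₀ (2 * R), v y ≠ ∞ →
      (∀ z r, 0 < r → box p z (κ * r) ⊆ box p z₀ (2 * R) →
        c₂ * volume (box p z r) ≤ volume (box p z (κ * r) ∩
          {y | c₁ * ((∫⁻ y in box p z r, v y) / volume (box p z r)) < v y})) →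
      ∫⁻ y in box p z₀ R, v y ^ (1 + δ) ≤ C * (∫⁻ y in box p z₀ (2 * R), v y) *
        ((∫⁻ y in box p z₀ (2 * R), v y) / volume (box p z₀ (2 * R))) ^ δ := by
  have hp0 : 0 < p := by linarith
  have h₀ : 0 < p⁻¹ := inv_pos.mpr hp0
  have h₁ : p⁻¹ ≤ 1 := inv_le_one_of_one_le₀ hp.le
  set e := toParabolic n h₀ h₁ with he
  set μ := (volume : Measure ((Fin n → ℝ) × ℝ)).map e with hμdef
  have hball : ∀ z (r : ℝ), 0 ≤ r → e ⁻¹' closedBall (e z) r = box p z r := fun z r hr =>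
    preimage_toParabolic_closedBall hp0 z hr
  have hvol : ∀ z (r : ℝ), 0 ≤ r → μ (closedBall (e z) r) = volume (box p z r) := fun z r hr => by
    rw [hμdef, e.map_apply, hball z r hr]
  have hμ : ∀ z (r : ℝ), 0 < r → μ (closedBall z r) = ENNReal.ofReal (2 ^ (n + 1) * r ^ (n + p)) := by
    intro z r hr
    obtain ⟨z, rfl⟩ := e.surjective z
    rw [hvol z r hr.le, volume_box p z hr]
  have hint : ∀ (f : (Fin n → ℝ) × ℝ → ℝ≥0∞) z (r : ℝ), 0 ≤ r →
      ∫⁻ y in closedBall (e z) r, f (e.symm y) ∂μ = ∫⁻ y in box p z r, f y := fun f z r hr => by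
    rw [hμdef, e.restrict_map, lintegral_map_equiv, hball z r hr]
    simp
  obtain ⟨δ, hδ, C, h⟩ := reverse_holder_of_superlevel (μ := μ) (c := 2 ^ (n + 1)) (D := n + p)
    (by positivity) (by positivity) hμ hκ hc₁ hc₁' hc₂
  refine ⟨δ, hδ, C, fun v hv z₀ R hR hI H => ?_⟩
  have := h (fun y => v (e.symm y)) (hv.comp e.symm.measurable) (e z₀) R hR
    (by rwa [hint v _ _ (by positivity)]) ?_
  · rwa [hint v _ _ (by positivity), hint (fun y => v y ^ (1 + δ)) _ _ hR.le,
      hvol _ _ (by positivity)] at this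
  · intro z r hr hsub
    obtain ⟨z, rfl⟩ := e.surjective z
    have hκr : 0 ≤ κ * r := by positivity
    have hsub' : box p z (κ * r) ⊆ box p z₀ (2 * R) := by
      rw [← hball _ _ hκr, ← hball _ _ (by positivity)]
      exact preimage_mono hsub
    rw [hint v _ _ hr.le, hvol _ _ hr.le, hμdef, e.map_apply, preimage_inter, hball _ _ hκr]
    simpa using H z r hr hsub'

/-! ### The `A_q⁺` condition and chains of boxes -/

/-- Hölder's inequality for a weight and its dual weight. -/
theorem volume_rpow_le_of_pos {α : Type*} [MeasurableSpace α] {μ : Measure α} {q : ℝ} (hq : 1 < q)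
    {W : α → ℝ≥0∞} (hW : Measurable W) (hWtop : ∀ z, W z ≠ ∞) {S : Set α}
    (hS : ∀ᵐ z ∂μ.restrict S, W z ≠ 0) :
    μ S ^ q ≤ (∫⁻ z in S, W z ∂μ) * (∫⁻ z in S, W z ^ (1 / (1 - q)) ∂μ) ^ (q - 1) := by
  have hq0 : 0 < q := by linarith
  have hq1 : 0 < q - 1 := by linarith
  have hq1' : 1 - q ≠ 0 := by linarith
  have hconj : q.HolderConjugate (q / (q - 1)) := Real.HolderConjugate.conjExponent hq
  have h := ENNReal.lintegral_mul_le_Lp_mul_Lq (μ.restrict S) hconj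
    (f := fun z => W z ^ (1 / q)) (g := fun z => W z ^ (-(1 / q)))
    (hW.pow_const _).aemeasurable (hW.pow_const _).aemeasurable
  have e1 : ∫⁻ z in S, ((fun z => W z ^ (1 / q)) * fun z => W z ^ (-(1 / q))) z ∂μ = μ S := by
    rw [← setLIntegral_one]
    refine lintegral_congr_ae ?_
    filter_upwards [hS] with z hz
    simp only [Pi.mul_apply]
    rw [← ENNReal.rpow_add _ _ hz (hWtop z), add_neg_cancel, ENNReal.rpow_zero]
  have e2 : ∀ z, (W z ^ (1 / q)) ^ q = W z := fun z => by
    rw [← ENNReal.rpow_mul, one_div_mul_cancel hq0.ne', ENNReal.rpow_one]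
  have e3 : ∀ z, (W z ^ (-(1 / q))) ^ (q / (q - 1)) = W z ^ (1 / (1 - q)) := fun z => by
    rw [← ENNReal.rpow_mul]
    congr 1
    have : q - 1 ≠ 0 := hq1.ne'
    rw [show 1 - q = -(q - 1) by ring]
    field_simp
  rw [e1] at h
  simp only [e2, e3] at h
  calc μ S ^ q ≤ ((∫⁻ z in S, W z ∂μ) ^ (1 / q) *
        (∫⁻ z in S, W z ^ (1 / (1 - q)) ∂μ) ^ (1 / (q / (q - 1)))) ^ q := by gcongr
    _ = _ := by
      rw [ENNReal.mul_rpow_of_nonneg _ _ hq0.le, ← ENNReal.rpow_mul, ← ENNReal.rpow_mul,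
        one_div_mul_cancel hq0.ne', ENNReal.rpow_one]
      congr 2
      field_simp

/-- The `A_q⁺(γ)` condition with constant `K`, for extended nonnegative functions. -/
def HasAqPlusBound {n : ℕ} (p q γ : ℝ) (K : ℝ≥0∞) (W : (Fin n → ℝ) × ℝ → ℝ≥0∞) : Prop :=
  ∀ (x : Fin n → ℝ) (t L : ℝ), 0 < L → (∫⁻ z in lowerPart p γ x t L, W z) *
    (∫⁻ z in upperPart p γ x t L, W z ^ (1 / (1 - q))) ^ (q - 1) ≤
      K * volume (upperPart p γ x t L) ^ q

variable {n : ℕ} {p q γ : ℝ}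

theorem volume_upperPart (x : Fin n → ℝ) (t : ℝ) {L : ℝ} (hL : 0 < L) :
    volume (upperPart p γ x t L) = ENNReal.ofReal (2 ^ n * (1 - γ) * L ^ (n + p)) := by
  rw [upperPart, Measure.volume_eq_prod, Measure.prod_prod, volume_cube _ hL.le, Real.volume_Ioo,
    ← ENNReal.ofReal_mul (by positivity), Real.rpow_add hL, Real.rpow_natCast]
  congr 1
  ring

theorem volume_lowerPart (x : Fin n → ℝ) (t : ℝ) {L : ℝ} (hL : 0 < L) :
    volume (lowerPart p γ x t L) = ENNReal.ofReal (2 ^ n * (1 - γ) * L ^ (n + p)) := by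
  rw [lowerPart, Measure.volume_eq_prod, Measure.prod_prod, volume_cube _ hL.le, Real.volume_Ioo,
    ← ENNReal.ofReal_mul (by positivity), Real.rpow_add hL, Real.rpow_natCast]
  congr 1
  ring

theorem measurableSet_lowerPart (x : Fin n → ℝ) (t L : ℝ) :
    MeasurableSet (lowerPart p γ x t L) := (measurableSet_cube _ _).prod measurableSet_Ioo

theorem cube_subset_cube {x y : Fin n → ℝ} {r L : ℝ} (h : ∀ i, |y i - x i| + r ≤ L) :
    cube y r ⊆ cube x L := fun z hz i => by
  have h1 : |z i - y i| ≤ r := hz i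
  have := abs_sub_le (z i) (y i) (x i)
  linarith [h i]

theorem box_subset_upperPart {z : (Fin n → ℝ) × ℝ} {x : Fin n → ℝ} {r t L : ℝ}
    (h : ∀ i, |z.1 i - x i| + r ≤ L) (h1 : t + γ * L ^ p < z.2 - r ^ p)
    (h2 : z.2 + r ^ p < t + L ^ p) : box p z r ⊆ upperPart p γ x t L :=
  prod_mono (cube_subset_cube h) fun _ hs => ⟨h1.trans_le hs.1, lt_of_le_of_lt hs.2 h2⟩

theorem box_subset_lowerPart {z : (Fin n → ℝ) × ℝ} {x : Fin n → ℝ} {r t L : ℝ}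
    (h : ∀ i, |z.1 i - x i| + r ≤ L) (h1 : t - L ^ p < z.2 - r ^ p)
    (h2 : z.2 + r ^ p < t - γ * L ^ p) : box p z r ⊆ lowerPart p γ x t L :=
  prod_mono (cube_subset_cube h) fun _ hs => ⟨h1.trans_le hs.1, lt_of_le_of_lt hs.2 h2⟩

theorem volume_upperPart_le_mul_volume_box (hγ0 : 0 < γ) {M r : ℝ} (hM : 0 < M) (hr : 0 < r)
    (x : Fin n → ℝ) (t : ℝ) (z : (Fin n → ℝ) × ℝ) :
    volume (upperPart p γ x t (M * r)) ≤ ENNReal.ofReal (M ^ (n + p)) * volume (box p z r) := by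
  rw [volume_upperPart _ _ (by positivity), volume_box _ _ hr, ← ENNReal.ofReal_mul (by positivity),
    Real.mul_rpow hM.le hr.le]
  refine ENNReal.ofReal_le_ofReal ?_
  have h : 0 < 2 ^ n * (M ^ (n + p) * r ^ (n + p)) := by positivity
  rw [pow_succ]
  nlinarith

/-- A scale `M` for which two boxes of radius `r` fit into the two parts of a rectangle of size
`M * r`. -/
theorem exists_scale (hp : 1 < p) (hγ1 : γ < 1) : ∃ M : ℝ, 2 ≤ M ∧ 4 ≤ (1 - γ) * M ^ p := by
  have h : 0 < 1 - γ := by linarith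
  refine ⟨max 2 ((4 / (1 - γ)) ^ p⁻¹), le_max_left _ _, ?_⟩
  have h4 : 0 < 4 / (1 - γ) := by positivity
  calc 4 = (1 - γ) * ((4 / (1 - γ)) ^ p⁻¹) ^ p := by
        rw [Real.rpow_inv_rpow h4.le (by linarith)]; field_simp
    _ ≤ _ := by
        gcongr
        exact le_max_right _ _

/-- Hölder on the later box bounds its volume by the integrals of W and its dual; inserting this in
the `A_q⁺` condition eliminates the dual weight. -/
theorem lintegral_box_le_mul_lintegral_box (hq : 1 < q) (hγ0 : 0 < γ) {K : ℝ≥0}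
    {W : (Fin n → ℝ) × ℝ → ℝ≥0∞} (hW : Measurable W) (hWtop : ∀ z, W z ≠ ∞)
    (hA : HasAqPlusBound p q γ K W) {M r : ℝ} (hM : 0 < M) (hr : 0 < r) {x : Fin n → ℝ} {t : ℝ}
    {z₁ z₂ : (Fin n → ℝ) × ℝ} (h₁ : box p z₁ r ⊆ lowerPart p γ x t (M * r))
    (h₂ : box p z₂ r ⊆ upperPart p γ x t (M * r)) :
    ∫⁻ z in box p z₁ r, W z ≤
      K * ENNReal.ofReal (M ^ (n + p)) ^ q * ∫⁻ z in box p z₂ r, W z := by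
  have hq0 : 0 < q := by linarith
  have hq1 : 0 < q - 1 := by linarith
  set b := volume (box p z₂ r) with hb
  have hb' : b = ENNReal.ofReal (2 ^ (n + 1) * r ^ (n + p)) := volume_box _ _ hr
  have hb0 : b ≠ 0 := by
    rw [hb', Ne, ENNReal.ofReal_eq_zero, not_le]; positivity
  have hbt : b ≠ ∞ := by rw [hb']; exact ENNReal.ofReal_ne_top
  have hbq0 : b ^ q ≠ 0 := (ENNReal.rpow_pos (pos_iff_ne_zero.mpr hb0) hbt).ne'
  have hbqt : b ^ q ≠ ∞ := ENNReal.rpow_ne_top_of_nonneg hq0.le hbt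
  have hm := volume_upperPart_le_mul_volume_box (p := p) hγ0 hM hr x t z₂
  have hmain := hA x t (M * r) (by positivity)
  have hmain' : (∫⁻ z in lowerPart p γ x t (M * r), W z) *
      (∫⁻ z in upperPart p γ x t (M * r), W z ^ (1 / (1 - q))) ^ (q - 1) ≤
      K * ENNReal.ofReal (M ^ (n + p)) ^ q * b ^ q := by
    refine hmain.trans ?_
    rw [mul_assoc, ← ENNReal.mul_rpow_of_nonneg _ _ hq0.le]
    gcongr
  have hlow : ∫⁻ z in box p z₁ r, W z ≤ ∫⁻ z in lowerPart p γ x t (M * r), W z :=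
    lintegral_mono_set h₁
  have hup : ∫⁻ z in box p z₂ r, W z ^ (1 / (1 - q)) ≤
      ∫⁻ z in upperPart p γ x t (M * r), W z ^ (1 / (1 - q)) := lintegral_mono_set h₂
  by_cases hpos : ∀ᵐ z ∂volume.restrict (box p z₂ r), W z ≠ 0
  · have hH := volume_rpow_le_of_pos hq hW hWtop hpos
    rw [← ENNReal.mul_le_mul_iff_left hbq0 hbqt]
    calc (∫⁻ z in box p z₁ r, W z) * b ^ q
        ≤ (∫⁻ z in lowerPart p γ x t (M * r), W z) * ((∫⁻ z in box p z₂ r, W z) *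
          (∫⁻ z in upperPart p γ x t (M * r), W z ^ (1 / (1 - q))) ^ (q - 1)) := by
          gcongr
          exact hH.trans (by gcongr)
      _ = (∫⁻ z in box p z₂ r, W z) * ((∫⁻ z in lowerPart p γ x t (M * r), W z) *
          (∫⁻ z in upperPart p γ x t (M * r), W z ^ (1 / (1 - q))) ^ (q - 1)) := by ring
      _ ≤ (∫⁻ z in box p z₂ r, W z) * (K * ENNReal.ofReal (M ^ (n + p)) ^ q * b ^ q) := by
          gcongr
      _ = _ := by ring
  -- If W vanishes on a non-null part of the later box, the dual integral is infinite, and the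
  -- condition forces W to have no mass in the earlier box.
  · have hinf : ∫⁻ z in box p z₂ r, W z ^ (1 / (1 - q)) = ∞ := by
      by_contra hne
      refine hpos ?_
      filter_upwards [ae_lt_top (hW.pow_const _) hne] with z hz h0
      rw [h0, ENNReal.zero_rpow_of_neg (by rw [one_div, inv_lt_zero]; linarith)] at hz
      exact lt_irrefl _ hz
    rw [hinf, top_le_iff] at hup
    rw [hup, ENNReal.top_rpow_of_pos hq1] at hmain'
    have h0 : ∫⁻ z in lowerPart p γ x t (M * r), W z = 0 := by
      by_contra hne
      rw [ENNReal.mul_top hne, top_le_iff] at hmain'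
      exact ENNReal.mul_ne_top (ENNReal.mul_ne_top ENNReal.coe_ne_top
        (ENNReal.rpow_ne_top_of_nonneg hq0.le ENNReal.ofReal_ne_top)) hbqt hmain'
    rw [h0] at hlow
    exact hlow.trans zero_le

/-- Two boxes with a suitable time lag lie in the two parts of a common rectangle. -/
theorem exists_rectangle {M r : ℝ} (hM : 2 ≤ M)
    (hMγ : 4 ≤ (1 - γ) * M ^ p) (hr : 0 < r) {z₁ z₂ : (Fin n → ℝ) × ℝ}
    (hx : ∀ i, |z₂.1 i - z₁.1 i| ≤ 2 * r) (ht₁ : (2 * M ^ p - 5) * r ^ p ≤ z₂.2 - z₁.2)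
    (ht₂ : z₂.2 - z₁.2 ≤ (2 * M ^ p - 3) * r ^ p) :
    ∃ x t, box p z₁ r ⊆ lowerPart p γ x t (M * r) ∧ box p z₂ r ⊆ upperPart p γ x t (M * r) := by
  have hu : 0 < r ^ p := by positivity
  have hL : (M * r) ^ p = M ^ p * r ^ p := Real.mul_rpow (by linarith) hr.le
  have hγM : γ * M ^ p * r ^ p ≤ (M ^ p - 4) * r ^ p := by gcongr; linarith
  -- The rectangle is centred at the midpoint. Half the lag lies between M^p - 5/2 and M^p - 3/2 in
  -- units of r^p, and γ M^p ≤ M^p - 4, which leaves room for the boxes.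
  refine ⟨fun i => (z₁.1 i + z₂.1 i) / 2, (z₁.2 + z₂.2) / 2, box_subset_lowerPart ?_ ?_ ?_,
    box_subset_upperPart ?_ ?_ ?_⟩
  · intro i
    have : |z₁.1 i - (z₁.1 i + z₂.1 i) / 2| ≤ r := by
      have := abs_le.mp (hx i)
      rw [abs_le]; constructor <;> linarith
    nlinarith
  · rw [hL]; nlinarith
  · rw [hL]; nlinarith
  · intro i
    have : |z₂.1 i - (z₁.1 i + z₂.1 i) / 2| ≤ r := by
      have := abs_le.mp (hx i)
      rw [abs_le]; constructor <;> linarith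
    nlinarith
  · rw [hL]; nlinarith
  · rw [hL]; nlinarith

/-- The displacement is cut into k + 1 equal steps. All but the last carry W forward; the last uses
the `A_q⁺` condition itself. -/
theorem chain_lintegral_box_le (hq : 1 < q) (hγ0 : 0 < γ) {K : ℝ≥0}
    {W : (Fin n → ℝ) × ℝ → ℝ≥0∞} (hW : Measurable W) (hWtop : ∀ z, W z ≠ ∞)
    (hA : HasAqPlusBound p q γ K W) {M r : ℝ} (hM : 2 ≤ M) (hMγ : 4 ≤ (1 - γ) * M ^ p)
    (hr : 0 < r) (k : ℕ) : ∀ {z₁ z₂ : (Fin n → ℝ) × ℝ},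
      (∀ i, |z₂.1 i - z₁.1 i| ≤ 2 * r * (k + 1)) →
      (2 * M ^ p - 5) * r ^ p * (k + 1) ≤ z₂.2 - z₁.2 →
      z₂.2 - z₁.2 ≤ (2 * M ^ p - 3) * r ^ p * (k + 1) →
      (∫⁻ z in box p z₁ r, W z) * (∫⁻ z in box p z₂ r, W z ^ (1 / (1 - q))) ^ (q - 1) ≤
        (K * ENNReal.ofReal (M ^ (n + p)) ^ q) ^ (k + 1) *
          ENNReal.ofReal (2 ^ (n + 1) * r ^ (n + p)) ^ q := by
  have hM0 : 0 < M := by linarith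
  have hq0 : 0 < q := by linarith
  induction k with
  | zero =>
    intro z₁ z₂ hx ht₁ ht₂
    obtain ⟨x, t, h₁, h₂⟩ := exists_rectangle hM hMγ hr (by simpa using hx)
      (by simpa using ht₁) (by simpa using ht₂)
    calc _ ≤ (∫⁻ z in lowerPart p γ x t (M * r), W z) *
          (∫⁻ z in upperPart p γ x t (M * r), W z ^ (1 / (1 - q))) ^ (q - 1) := by
          gcongr
      _ ≤ K * volume (upperPart p γ x t (M * r)) ^ q := hA x t _ (by positivity)
      _ ≤ K * (ENNReal.ofReal (M ^ (n + p)) * volume (box p z₁ r)) ^ q := by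
          gcongr
          exact volume_upperPart_le_mul_volume_box hγ0 hM0 hr x t z₁
      _ = _ := by
          rw [volume_box _ _ hr, ENNReal.mul_rpow_of_nonneg _ _ hq0.le, zero_add, pow_one, mul_assoc]
  | succ k ih =>
    intro z₁ z₂ hx ht₁ ht₂
    push_cast at hx ht₁ ht₂
    have hk : (0 : ℝ) < k + 1 + 1 := by positivity
    set z : (Fin n → ℝ) × ℝ := (fun i => z₁.1 i + (z₂.1 i - z₁.1 i) / (k + 1 + 1),
      z₁.2 + (z₂.2 - z₁.2) / (k + 1 + 1)) with hz
    have e1 : ∀ i, z.1 i - z₁.1 i = (z₂.1 i - z₁.1 i) / (k + 1 + 1) := fun i => by simp [hz]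
    have e2 : z.2 - z₁.2 = (z₂.2 - z₁.2) / (k + 1 + 1) := by simp [hz]
    have e3 : ∀ i, z₂.1 i - z.1 i = (z₂.1 i - z₁.1 i) / (k + 1 + 1) * (k + 1) := fun i => by
      simp only [hz]; field_simp; ring
    have e4 : z₂.2 - z.2 = (z₂.2 - z₁.2) / (k + 1 + 1) * (k + 1) := by
      simp only [hz]; field_simp; ring
    have f1 : ∀ i, |(z₂.1 i - z₁.1 i) / (k + 1 + 1)| ≤ 2 * r := fun i => by
      rw [abs_div, abs_of_pos hk, div_le_iff₀ hk]; exact hx i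
    have f2 : (2 * M ^ p - 5) * r ^ p ≤ (z₂.2 - z₁.2) / (k + 1 + 1) := by
      rw [le_div_iff₀ hk]; exact ht₁
    have f3 : (z₂.2 - z₁.2) / (k + 1 + 1) ≤ (2 * M ^ p - 3) * r ^ p := by
      rw [div_le_iff₀ hk]; exact ht₂
    obtain ⟨x, t, h₁, h₂⟩ := exists_rectangle (z₁ := z₁) (z₂ := z) hM hMγ hr
      (fun i => by rw [e1]; exact f1 i) (by rw [e2]; exact f2) (by rw [e2]; exact f3)
    have hstep := lintegral_box_le_mul_lintegral_box hq hγ0 hW hWtop hA hM0 hr h₁ h₂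
    have hk1 : (0 : ℝ) < k + 1 := by positivity
    have hih := ih (z₁ := z) (z₂ := z₂)
      (fun i => by rw [e3, abs_mul, abs_of_pos hk1]; gcongr; exact f1 i)
      (by rw [e4]; gcongr) (by rw [e4]; gcongr)
    calc _ ≤ (K * ENNReal.ofReal (M ^ (n + p)) ^ q * ∫⁻ z in box p z r, W z) *
          (∫⁻ z in box p z₂ r, W z ^ (1 / (1 - q))) ^ (q - 1) := by gcongr
      _ = K * ENNReal.ofReal (M ^ (n + p)) ^ q * ((∫⁻ z in box p z r, W z) *
          (∫⁻ z in box p z₂ r, W z ^ (1 / (1 - q))) ^ (q - 1)) := by ring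
      _ ≤ K * ENNReal.ofReal (M ^ (n + p)) ^ q *
          ((K * ENNReal.ofReal (M ^ (n + p)) ^ q) ^ (k + 1) *
            ENNReal.ofReal (2 ^ (n + 1) * r ^ (n + p)) ^ q) := by gcongr
      _ = _ := by rw [pow_succ _ (k + 1)]; ring

theorem box_subset_box (hp : 0 ≤ p) (z : (Fin n → ℝ) × ℝ) {r R : ℝ} (hr : 0 ≤ r) (h : r ≤ R) :
    box p z r ⊆ box p z R := by
  have : r ^ p ≤ R ^ p := Real.rpow_le_rpow hr h hp
  exact prod_mono (fun y hy i => (hy i).trans h)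
    (Icc_subset_Icc (by linarith) (by linarith))

/-- The `A_q⁺(γ)` condition controls two small boxes with an arbitrarily short relative time lag.
This is where `1 < p` is used. -/
theorem exists_lintegral_box_mul_le (hp : 1 < p) (hq : 1 < q) (hγ0 : 0 < γ) (hγ1 : γ < 1)
    (K : ℝ≥0) {γ' : ℝ} (hγ' : 0 < γ') :
    ∃ a : ℝ, 0 < a ∧ ∃ C : ℝ≥0, ∀ W : (Fin n → ℝ) × ℝ → ℝ≥0∞, Measurable W → (∀ z, W z ≠ ∞) →
      HasAqPlusBound p q γ K W → ∀ (L : ℝ), 0 < L → ∀ z₁ z₂ : (Fin n → ℝ) × ℝ,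
        (∀ i, |z₂.1 i - z₁.1 i| ≤ 2 * L) → 2 * γ' * L ^ p ≤ z₂.2 - z₁.2 →
        z₂.2 - z₁.2 ≤ 2 * L ^ p →
        (∫⁻ z in box p z₁ (a * L), W z) *
          (∫⁻ z in box p z₂ (a * L), W z ^ (1 / (1 - q))) ^ (q - 1) ≤
            C * ENNReal.ofReal (2 ^ (n + 1) * (a * L) ^ (n + p)) ^ q := by
  obtain ⟨M, hM, hMγ⟩ := exists_scale hp hγ1
  have hq0 : 0 < q := by linarith
  -- The largest time lag of one step, in units of r^p.
  set τ : ℝ := 2 * M ^ p - 3 with hτ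
  have hτ5 : 5 ≤ τ := by
    have : 0 < M ^ p := by positivity
    nlinarith
  have hp1 : 0 < p - 1 := by linarith
  -- With r = aL and lag T ≥ 2γ'L^p, about y = T/(τ r^p) steps are made. The bound a^(p-1) ≤ b gives
  -- ay ≥ τ: the spatial reach 2ry exceeds 2L, and y ≥ τ leaves room for rounding y up.
  set b : ℝ := 2 * γ' / τ ^ 2 with hb
  have hb0 : 0 < b := by positivity
  set a : ℝ := min 1 (b ^ (p - 1)⁻¹) with ha
  have ha0 : 0 < a := lt_min one_pos (by positivity)
  have ha1 : a ≤ 1 := min_le_left _ _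
  have hab : a ^ (p - 1) ≤ b := by
    calc a ^ (p - 1) ≤ (b ^ (p - 1)⁻¹) ^ (p - 1) := by
          gcongr
          exact min_le_right _ _
      _ = b := Real.rpow_inv_rpow hb0.le hp1.ne'
  have hap : a ^ p = a * a ^ (p - 1) := by
    rw [← Real.rpow_one_add' ha0.le (by linarith)]; ring_nf
  have hapos : 0 < a ^ (p - 1) := by positivity
  set C₁ : ℝ≥0∞ := K * ENNReal.ofReal (M ^ (n + p)) ^ q with hC₁
  have hC₁t : C₁ ≠ ∞ := ENNReal.mul_ne_top ENNReal.coe_ne_top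
    (ENNReal.rpow_ne_top_of_nonneg hq0.le ENNReal.ofReal_ne_top)
  -- Bounds the number of steps, because T ≤ 2L^p.
  set N₀ : ℕ := ⌈2 / (τ * a ^ p)⌉₊ with hN₀
  have hCt : (1 + C₁) ^ N₀ ≠ ∞ :=
    ENNReal.pow_ne_top (ENNReal.add_ne_top.mpr ⟨ENNReal.one_ne_top, hC₁t⟩)
  refine ⟨a, ha0, ((1 + C₁) ^ N₀).toNNReal, fun W hW hWt hA L hL z₁ z₂ hx ht₁ ht₂ => ?_⟩
  have hr : 0 < a * L := by positivity
  set T : ℝ := z₂.2 - z₁.2 with hT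
  have hLp : 0 < L ^ p := by positivity
  have hT0 : 0 < T := lt_of_lt_of_le (by positivity) ht₁
  have hu : (a * L) ^ p = a * a ^ (p - 1) * L ^ p := by rw [Real.mul_rpow ha0.le hL.le, hap]
  have hu0 : 0 < (a * L) ^ p := by positivity
  have hTτ : τ ^ 2 * (a ^ (p - 1) * L ^ p) ≤ T := by
    refine le_trans ?_ ht₁
    rw [← mul_assoc]
    gcongr ?_ * _
    calc τ ^ 2 * a ^ (p - 1) ≤ τ ^ 2 * b := by gcongr
      _ = 2 * γ' := by rw [hb]; field_simp
  have hTu : τ ^ 2 * (a * L) ^ p ≤ T := by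
    refine le_trans ?_ hTτ
    rw [hu]
    have : 0 < a ^ (p - 1) * L ^ p := by positivity
    gcongr
    nlinarith
  set y : ℝ := T / (τ * (a * L) ^ p) with hy
  have hy0 : 0 < y := by positivity
  have hyT : T = y * (τ * (a * L) ^ p) := by rw [hy]; field_simp
  obtain ⟨k, hk⟩ : ∃ k : ℕ, ⌈y⌉₊ = k + 1 :=
    Nat.exists_eq_add_one.mpr (Nat.ceil_pos.mpr hy0)
  have hk1 : y ≤ k + 1 := by exact_mod_cast hk ▸ Nat.le_ceil y
  have hk2 : (k : ℝ) + 1 < y + 1 := by exact_mod_cast hk ▸ Nat.ceil_lt_add_one hy0.le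
  have hyτ : τ ≤ y := by
    rw [hy, le_div_iff₀ (by positivity)]
    linarith
  have hkN : k + 1 ≤ N₀ := by
    rw [← hk, hN₀]
    refine Nat.ceil_mono ?_
    rw [hy, Real.mul_rpow ha0.le hL.le, div_le_div_iff₀ (by positivity) (by positivity)]
    have : 0 < τ * a ^ p := by positivity
    nlinarith
  have hspace : 2 * L ≤ 2 * (a * L) * y := by
    have h1 : τ * (a * L) ^ p ≤ a * T / τ := by
      rw [le_div_iff₀ (by positivity), hu]
      calc τ * (a * a ^ (p - 1) * L ^ p) * τ = a * (τ ^ 2 * (a ^ (p - 1) * L ^ p)) := by ring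
        _ ≤ a * T := by gcongr
    have h2 : τ ≤ a * y := by
      have hpos : 0 < τ * (a * L) ^ p := by positivity
      rw [hy, ← mul_div_assoc, le_div_iff₀ hpos]
      rw [le_div_iff₀ (by positivity)] at h1
      linarith
    nlinarith
  have hchain := chain_lintegral_box_le hq hγ0 hW hWt hA hM hMγ hr k (z₁ := z₁) (z₂ := z₂)
    (fun i => (hx i).trans (hspace.trans (by gcongr))) ?_ ?_
  · refine hchain.trans ?_
    rw [ENNReal.coe_toNNReal hCt]
    gcongr ?_ * _
    calc C₁ ^ (k + 1) ≤ (1 + C₁) ^ (k + 1) := by gcongr; exact le_add_self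
      _ ≤ _ := pow_le_pow_right₀ le_self_add hkN
  · change _ ≤ T
    rw [hyT]
    -- Rounding up shortens each step's lag; it stays above τ - 2 because (τ - 2)(y + 1) ≤ τy when y
    -- ≥ τ.
    have h1 : (2 * M ^ p - 5) * (k + 1) ≤ y * τ := by
      have : 2 * M ^ p - 5 = τ - 2 := by rw [hτ]; ring
      rw [this]; nlinarith
    calc _ = (2 * M ^ p - 5) * (k + 1) * (a * L) ^ p := by ring
      _ ≤ y * τ * (a * L) ^ p := by gcongr
      _ = _ := by ring
  · change T ≤ _
    rw [hyT]
    calc y * (τ * (a * L) ^ p) ≤ (k + 1) * (τ * (a * L) ^ p) := by gcongr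
      _ = _ := by rw [hτ]; ring

/-! ### Superlevel sets of the dual weight -/

/-- The dual weight is comparable to its mean over a box on a large part of a larger box. -/
theorem exists_superlevel_dual_weight (hp : 1 < p) (hq : 1 < q) (hγ0 : 0 < γ) (hγ1 : γ < 1)
    (K : ℝ≥0) : ∃ κ : ℝ, 1 ≤ κ ∧ ∃ c₁ : ℝ≥0, c₁ ≠ 0 ∧ c₁ ≤ 1 ∧
      ∀ W : (Fin n → ℝ) × ℝ → ℝ≥0∞, Measurable W → (∀ z, W z ≠ ∞) →
      HasAqPlusBound p q γ K W → ∀ z r, 0 < r → ∫⁻ y in box p z r, W y ^ (1 / (1 - q)) ≠ ∞ →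
        ((1 / 2 : ℝ≥0) : ℝ≥0∞) * volume (box p z r) ≤ volume (box p z (κ * r) ∩
          {y | c₁ * ((∫⁻ y in box p z r, W y ^ (1 / (1 - q))) / volume (box p z r)) <
            W y ^ (1 / (1 - q))}) := by
  obtain ⟨M, hM, hMγ⟩ := exists_scale hp hγ1
  have hq0 : 0 < q := by linarith
  have hq1 : 0 < q - 1 := by linarith
  have hM0 : 0 < M := by linarith
  set ρ : ℝ≥0 := (M ^ (n + p)).toNNReal with hρ
  have hρ0 : 0 < ρ := Real.toNNReal_pos.mpr (by positivity)
  set e : ℝ≥0 := (2 ^ q * (K + 1))⁻¹ with he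
  have he0 : 0 < e := by positivity
  set c₁ : ℝ≥0 := min 1 (e ^ (q - 1)⁻¹ / ρ) with hc₁
  have hc₁0 : 0 < c₁ := lt_min one_pos (by positivity)
  have hc : (c₁ * ρ) ^ (q - 1) * K ≤ (2 ^ q)⁻¹ := by
    calc (c₁ * ρ) ^ (q - 1) * K ≤ (e ^ (q - 1)⁻¹ / ρ * ρ) ^ (q - 1) * (K + 1) := by
          gcongr
          · exact min_le_right _ _
          · exact le_self_add
      _ = (2 ^ q)⁻¹ := by
          rw [div_mul_cancel₀ _ hρ0.ne', NNReal.rpow_inv_rpow hq1.ne', he]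
          field_simp
  refine ⟨2 * M, by linarith, c₁, hc₁0.ne', min_le_left _ _, fun W hW hWt hA z r hr hS => ?_⟩
  set σ : (Fin n → ℝ) × ℝ → ℝ≥0∞ := fun y => W y ^ (1 / (1 - q)) with hσ
  have hσm : Measurable σ := hW.pow_const _
  set S : ℝ≥0∞ := ∫⁻ y in box p z r, σ y with hSdef
  set b := volume (box p z r) with hb
  have hb' : b = ENNReal.ofReal (2 ^ (n + 1) * r ^ (n + p)) := volume_box _ _ hr
  have hb0 : b ≠ 0 := by rw [hb', Ne, ENNReal.ofReal_eq_zero, not_le]; positivity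
  have hbt : b ≠ ∞ := by rw [hb']; exact ENNReal.ofReal_ne_top
  have hL : 0 < M * r := by positivity
  have hu : 0 < r ^ p := by positivity
  have hLp : (M * r) ^ p = M ^ p * r ^ p := Real.mul_rpow hM0.le hr.le
  have hMp : 4 ≤ M ^ p := by
    have : 0 < M ^ p := by positivity
    nlinarith
  -- Puts the box in the middle of the upper part in time.
  set t : ℝ := z.2 - (1 + γ) / 2 * (M * r) ^ p with ht
  have hgap : 4 * r ^ p ≤ (1 - γ) * (M * r) ^ p := by
    rw [hLp, ← mul_assoc]; gcongr
  have hsub : box p z r ⊆ upperPart p γ z.1 t (M * r) := by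
    refine box_subset_upperPart (fun i => ?_) ?_ ?_
    · rw [sub_self, abs_zero]; nlinarith
    · rw [ht]; linarith
    · rw [ht]; linarith
  have hκp : 2 * (M * r) ^ p ≤ (2 * M * r) ^ p := by
    rw [mul_assoc, Real.mul_rpow (by norm_num) hL.le]
    gcongr
    calc (2 : ℝ) = 2 ^ (1 : ℝ) := (Real.rpow_one 2).symm
      _ ≤ 2 ^ p := Real.rpow_le_rpow_of_exponent_le (by norm_num) hp.le
  have hLp0 : 0 < (M * r) ^ p := by positivity
  have hγL : γ * (M * r) ^ p ≤ (M * r) ^ p := by nlinarith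
  have hγL0 : 0 < γ * (M * r) ^ p := by positivity
  have hlow : lowerPart p γ z.1 t (M * r) ⊆ box p z (2 * M * r) := by
    refine prod_mono (fun y hy i => (hy i).trans (by nlinarith)) fun s hs => ⟨?_, ?_⟩
    · have := hs.1; simp only [ht] at this; linarith
    · have := hs.2; simp only [ht] at this; linarith
  set Q := lowerPart p γ z.1 t (M * r) with hQ
  have hQm : MeasurableSet Q := measurableSet_lowerPart _ _ _
  set m := volume (upperPart p γ z.1 t (M * r)) with hm
  have hQv : volume Q = m := by rw [hQ, volume_lowerPart _ _ hL, hm, volume_upperPart _ _ hL]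
  have hbm : b ≤ m := measure_mono hsub
  have hmt : m ≠ ∞ := by rw [hm, volume_upperPart _ _ hL]; exact ENNReal.ofReal_ne_top
  have hmb : m ≤ ρ * b := volume_upperPart_le_mul_volume_box hγ0 hM0 hr _ _ _
  -- The bad set, where σ is small. By the choice of c₁ it fills at most half of the lower part, and
  -- the other half has at least half the volume of the box.
  set E := Q ∩ {y | σ y ≤ c₁ * (S / b)} with hE
  have hEσ : ∫⁻ y in E, σ y ≤ c₁ * ρ * S := by
    calc ∫⁻ y in E, σ y ≤ ∫⁻ y in E, c₁ * (S / b) := by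
          refine setLIntegral_mono measurable_const fun y hy => hy.2
      _ = c₁ * (S / b) * volume E := setLIntegral_const _ _
      _ ≤ c₁ * (S / b) * (ρ * b) := by
          gcongr
          exact (measure_mono inter_subset_left).trans (hQv.trans_le hmb)
      _ = c₁ * ρ * (S / b * b) := by ring
      _ = c₁ * ρ * S := by rw [ENNReal.div_mul_cancel hb0 hbt]
  have hSbt : c₁ * (S / b) ≠ ∞ :=
    ENNReal.mul_ne_top ENNReal.coe_ne_top (ENNReal.div_ne_top hS hb0)
  have hEm : MeasurableSet E := hQm.inter (measurableSet_le hσm measurable_const)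
  have hEpos : ∀ᵐ y ∂volume.restrict E, W y ≠ 0 := by
    filter_upwards [ae_restrict_mem hEm] with y hy h0
    have h1 : σ y ≤ c₁ * (S / b) := hy.2
    have h2 : σ y = ∞ := by
      simp only [hσ, h0]
      exact ENNReal.zero_rpow_of_neg (by rw [one_div, inv_lt_zero]; linarith)
    rw [h2, top_le_iff] at h1
    exact hSbt h1
  have hEvol : volume E ≤ m / 2 := by
    have h1 : volume E ^ q ≤ (m / 2) ^ q := by
      calc volume E ^ q ≤ (∫⁻ y in E, W y) * (∫⁻ y in E, σ y) ^ (q - 1) :=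
            volume_rpow_le_of_pos hq hW hWt hEpos
        _ ≤ (∫⁻ y in Q, W y) * (c₁ * ρ * S) ^ (q - 1) := by
            gcongr
            exact inter_subset_left
        _ ≤ (∫⁻ y in Q, W y) *
            (c₁ * ρ * ∫⁻ y in upperPart p γ z.1 t (M * r), σ y) ^ (q - 1) := by
            gcongr
            exact lintegral_mono_set hsub
        _ = (c₁ * ρ) ^ (q - 1) * ((∫⁻ y in Q, W y) *
            (∫⁻ y in upperPart p γ z.1 t (M * r), σ y) ^ (q - 1)) := by
            rw [ENNReal.mul_rpow_of_nonneg _ _ hq1.le]; ring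
        _ ≤ (c₁ * ρ) ^ (q - 1) * (K * m ^ q) := by
            gcongr _ * ?_
            exact hA z.1 t (M * r) hL
        _ = ((c₁ * ρ) ^ (q - 1) * K) * m ^ q := by ring
        _ ≤ (2 ^ q)⁻¹ * m ^ q := by
            gcongr
            have := ENNReal.coe_le_coe.mpr hc
            rw [ENNReal.coe_mul, ENNReal.coe_rpow_of_nonneg _ hq1.le, ENNReal.coe_mul,
              ENNReal.coe_inv (by positivity), ENNReal.coe_rpow_of_nonneg _ hq0.le,
              ENNReal.coe_ofNat] at this
            exact this
        _ = (m / 2) ^ q := by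
            rw [ENNReal.div_rpow_of_nonneg _ _ hq0.le, div_eq_mul_inv, mul_comm]
    exact (ENNReal.rpow_le_rpow_iff hq0).mp h1
  calc ((1 / 2 : ℝ≥0) : ℝ≥0∞) * b ≤ m / 2 := by
        rw [ENNReal.div_eq_inv_mul]
        gcongr
        simp
    _ = m - m / 2 := (ENNReal.sub_half hmt).symm
    _ ≤ volume Q - volume E := by rw [hQv]; gcongr
    _ ≤ volume (Q \ E) := le_measure_sdiff
    _ ≤ _ := by
        refine measure_mono fun y hy => ⟨hlow hy.1, ?_⟩
        change c₁ * (S / b) < σ y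
        by_contra hcon
        exact hy.2 ⟨hy.1, not_lt.mp hcon⟩

/-! ### Covering and self-improvement -/

/-- Both parts of a parabolic rectangle are covered by a fixed number of boxes of comparable
size. -/
theorem exists_finset_cover {a : ℝ} (ha : 0 < a) (γ : ℝ) :
    ∃ F : Finset ((Fin n → ℝ) × ℝ), (∀ f ∈ F, (∀ i, |f.1 i| ≤ 1) ∧ γ ≤ f.2 ∧ f.2 ≤ 1) ∧
      ∀ (x : Fin n → ℝ) (t L : ℝ), 0 < L →
        upperPart p γ x t L ⊆ ⋃ f ∈ F, box p (x + L • f.1, t + L ^ p * f.2) (a * L) ∧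
        lowerPart p γ x t L ⊆ ⋃ f ∈ F, box p (x + L • f.1, t - L ^ p * f.2) (a * L) := by
  have hcomp : IsCompact (closedBall (0 : Fin n → ℝ) 1 ×ˢ Icc γ 1) :=
    (isCompact_closedBall _ _).prod isCompact_Icc
  have hap : 0 < a ^ p := by positivity
  -- Compactness at unit scale; parabolic scaling and time reflection transfer the same finite set
  -- to every rectangle.
  obtain ⟨F, hF, hcov⟩ := hcomp.elim_nhds_subcover (fun z => box p z a) fun z _ => by
    rw [box, cube_eq_closedBall _ ha.le]
    exact prod_mem_nhds (closedBall_mem_nhds _ ha) (Icc_mem_nhds (by linarith) (by linarith))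
  have hcov' : ∀ y : Fin n → ℝ, ∀ s : ℝ, (∀ i, |y i| ≤ 1) → γ ≤ s → s ≤ 1 →
      ∃ f ∈ F, (∀ i, |y i - f.1 i| ≤ a) ∧ |s - f.2| ≤ a ^ p := by
    intro y s hy hs hs'
    have hmem : (y, s) ∈ closedBall (0 : Fin n → ℝ) 1 ×ˢ Icc γ 1 := by
      refine ⟨?_, hs, hs'⟩
      rw [← cube_eq_closedBall _ zero_le_one]
      intro i
      simpa using hy i
    obtain ⟨f, hf, h⟩ := mem_iUnion₂.mp (hcov hmem)
    refine ⟨f, hf, h.1, ?_⟩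
    have h1 := h.2.1
    have h2 := h.2.2
    rw [abs_le]
    constructor <;> linarith
  refine ⟨F, fun f hf => ?_, fun x t L hL => ?_⟩
  · have h := hF f hf
    have h1 := h.1
    rw [← cube_eq_closedBall _ zero_le_one] at h1
    exact ⟨fun i => by simpa using h1 i, h.2⟩
  have hLp : 0 < L ^ p := by positivity
  have haL : (a * L) ^ p = a ^ p * L ^ p := Real.mul_rpow ha.le hL.le
  have hspace : ∀ (y : Fin n → ℝ) (f : (Fin n → ℝ) × ℝ),
      (∀ i, |(y i - x i) / L - f.1 i| ≤ a) → y ∈ cube (x + L • f.1) (a * L) := by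
    intro y f h i
    have e : y i - (x + L • f.1) i = ((y i - x i) / L - f.1 i) * L := by
      simp only [Pi.add_apply, Pi.smul_apply, smul_eq_mul]; field_simp; ring
    rw [e, abs_mul, abs_of_pos hL]
    gcongr
    exact h i
  have hcube : ∀ y ∈ cube x L, ∀ i, |(y i - x i) / L| ≤ 1 := fun y hy i => by
    rw [abs_div, abs_of_pos hL, div_le_one hL]; exact hy i
  constructor
  · intro z hz
    have h1 := hz.2.1
    have h2 := hz.2.2
    obtain ⟨f, hf, hfx, hft⟩ := hcov' (fun i => (z.1 i - x i) / L) ((z.2 - t) / L ^ p)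
      (hcube _ hz.1) (by rw [le_div_iff₀ hLp]; linarith) (by rw [div_le_one hLp]; linarith)
    refine mem_iUnion₂.mpr ⟨f, hf, hspace _ _ hfx, ?_⟩
    have e : z.2 = t + L ^ p * f.2 + ((z.2 - t) / L ^ p - f.2) * L ^ p := by field_simp; ring
    rw [abs_le] at hft
    rw [mem_Icc, haL]
    constructor <;> nlinarith
  · intro z hz
    have h1 := hz.2.1
    have h2 := hz.2.2
    obtain ⟨f, hf, hfx, hft⟩ := hcov' (fun i => (z.1 i - x i) / L) ((t - z.2) / L ^ p)
      (hcube _ hz.1) (by rw [le_div_iff₀ hLp]; linarith) (by rw [div_le_one hLp]; linarith)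
    refine mem_iUnion₂.mpr ⟨f, hf, hspace _ _ hfx, ?_⟩
    have e : z.2 = t - L ^ p * f.2 - ((t - z.2) / L ^ p - f.2) * L ^ p := by field_simp; ring
    rw [abs_le] at hft
    rw [mem_Icc, haL]
    constructor <;> nlinarith

theorem volume_box_eq_mul_volume_upperPart {γ' a L : ℝ} (hγ' : γ' < 1) (ha : 0 < a) (hL : 0 < L)
    (x : Fin n → ℝ) (t : ℝ) (z : (Fin n → ℝ) × ℝ) :
    volume (box p z (a * L)) = ENNReal.ofReal (2 * a ^ (n + p) / (1 - γ')) *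
      volume (upperPart p γ' x t L) := by
  have h : 0 < 1 - γ' := by linarith
  rw [volume_box _ _ (by positivity), volume_upperPart _ _ hL, ← ENNReal.ofReal_mul (by positivity),
    Real.mul_rpow ha.le hL.le]
  congr 1
  field_simp
  ring

theorem setLIntegral_biUnion_finset_le {ι α : Type*} [MeasurableSpace α] {μ : Measure α}
    (F : Finset ι) (S : ι → Set α) (f : α → ℝ≥0∞) :
    ∫⁻ z in ⋃ i ∈ F, S i, f z ∂μ ≤ ∑ i ∈ F, ∫⁻ z in S i, f z ∂μ := by
  rw [← Finset.sum_coe_sort F fun i => ∫⁻ z in S i, f z ∂μ]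
  refine le_trans (lintegral_mono_set ?_)
    ((lintegral_iUnion_le (fun i : F => S i) f).trans (tsum_fintype _).le)
  exact iUnion₂_subset fun i hi => subset_iUnion (fun i : F => S i) ⟨i, hi⟩

/-- The sum is at most its number of terms times the largest, which treats s < 1 and s ≥ 1 alike. -/
theorem mul_sum_rpow_le {ι : Type*} (F : Finset ι) (Y : ι → ℝ≥0∞) {A B : ℝ≥0∞} {s : ℝ}
    (hs : 0 < s) (h : ∀ f ∈ F, A * Y f ^ s ≤ B) :
    A * (∑ f ∈ F, Y f) ^ s ≤ (F.card : ℝ≥0∞) ^ s * B := by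
  rcases F.eq_empty_or_nonempty with rfl | hne
  · simp [ENNReal.zero_rpow_of_pos hs]
  obtain ⟨g, hg, hmax⟩ := F.exists_max_image Y hne
  calc A * (∑ f ∈ F, Y f) ^ s ≤ A * (F.card * Y g) ^ s := by
        gcongr
        rw [← nsmul_eq_mul]
        exact Finset.sum_le_card_nsmul F Y _ hmax
    _ = (F.card : ℝ≥0∞) ^ s * (A * Y g ^ s) := by
        rw [ENNReal.mul_rpow_of_nonneg _ _ hs.le]; ring
    _ ≤ _ := by gcongr; exact h g hg

/-- From a bound for `A * I ^ (q - 1)` and a reverse Hölder inequality to a bound with an improved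
exponent. -/
theorem mul_rpow_le_of_reverse_holder {A I Y B b C : ℝ≥0∞} {q δ : ℝ} (hq : 1 < q) (hδ : 0 < δ)
    (hb0 : b ≠ 0) (hbt : b ≠ ∞) (hB : B ≠ ∞) (h : A * I ^ (q - 1) ≤ B * b ^ q)
    (hY : I ≠ ∞ → Y ≤ C * I * (I / b) ^ δ) :
    A * Y ^ ((q - 1) / (1 + δ)) ≤
      C ^ ((q - 1) / (1 + δ)) * B * b ^ (1 + (q - 1) / (1 + δ)) := by
  have hq1 : 0 < q - 1 := by linarith
  set s := (q - 1) / (1 + δ) with hs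
  have hs0 : 0 < s := by positivity
  have hsδ : s * (1 + δ) = q - 1 := by rw [hs]; field_simp
  rcases eq_or_ne A 0 with rfl | hA
  · simp
  -- For A ≠ 0 the assumed bound excludes I = ∞, so the reverse Hölder inequality is available.
  have hI : I ≠ ∞ := by
    rintro rfl
    rw [ENNReal.top_rpow_of_pos hq1, ENNReal.mul_top hA, top_le_iff] at h
    exact ENNReal.mul_ne_top hB (ENNReal.rpow_ne_top_of_nonneg (by linarith) hbt) h
  have e : (C * I * (I / b) ^ δ) ^ s = C ^ s * I ^ (q - 1) * b ^ (-(δ * s)) := by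
    have e1 : I * (I / b) ^ δ = I ^ (1 + δ) * b ^ (-δ) := by
      rw [ENNReal.div_rpow_of_nonneg _ _ hδ.le, ENNReal.rpow_add_of_nonneg _ _ zero_le_one hδ.le,
        ENNReal.rpow_one, ENNReal.rpow_neg, div_eq_mul_inv, mul_assoc]
    rw [mul_assoc, e1, ENNReal.mul_rpow_of_nonneg _ _ hs0.le, ENNReal.mul_rpow_of_nonneg _ _ hs0.le,
      ← ENNReal.rpow_mul, ← ENNReal.rpow_mul, mul_comm (1 + δ) s, hsδ, neg_mul, mul_assoc]
  calc A * Y ^ s ≤ A * (C * I * (I / b) ^ δ) ^ s := by gcongr; exact hY hI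
    _ = C ^ s * (A * I ^ (q - 1)) * b ^ (-(δ * s)) := by rw [e]; ring
    _ ≤ C ^ s * (B * b ^ q) * b ^ (-(δ * s)) := by gcongr
    _ = C ^ s * B * (b ^ q * b ^ (-(δ * s))) := by ring
    _ = _ := by
      rw [← ENNReal.rpow_add _ _ hb0 hbt]
      congr 2
      linarith

/-- Self-improvement of the `A_q⁺(γ)` condition. -/
theorem exists_hasAqPlusBound_sub (n : ℕ) (hp : 1 < p) (hq : 1 < q) (hγ0 : 0 < γ) (hγ1 : γ < 1)
    (K : ℝ≥0) : ∃ ε : ℝ, 0 < ε ∧ ε < q - 1 ∧ ∀ γ' : ℝ, 0 < γ' → γ' < 1 → ∃ C : ℝ≥0,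
      ∀ W : (Fin n → ℝ) × ℝ → ℝ≥0∞, Measurable W → (∀ z, W z ≠ ∞) →
        HasAqPlusBound p q γ K W → HasAqPlusBound p (q - ε) γ' C W := by
  have hq1 : 0 < q - 1 := by linarith
  have hq0 : 0 < q := by linarith
  obtain ⟨κ, hκ, c₁, hc₁0, hc₁1, hsuper⟩ :=
    exists_superlevel_dual_weight (n := n) hp hq hγ0 hγ1 K
  obtain ⟨δ, hδ, C₁, hRH⟩ := reverse_holder_box n hp hκ hc₁0 hc₁1
    (c₂ := 1 / 2) (by norm_num)
  -- The new exponent is 1 + s: the dual power -1/s is 1 + δ times 1/(1-q).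
  set s : ℝ := (q - 1) / (1 + δ) with hs
  have hs0 : 0 < s := by positivity
  have hsε : q - (q - 1) * δ / (1 + δ) = 1 + s := by rw [hs]; field_simp; ring
  refine ⟨(q - 1) * δ / (1 + δ), by positivity, ?_, fun γ' hγ'0 hγ'1 => ?_⟩
  · rw [div_lt_iff₀ (by positivity)]; nlinarith
  obtain ⟨a, ha, C₂, hC₂⟩ := exists_lintegral_box_mul_le (n := n) hp hq hγ0 hγ1 K hγ'0
  -- Radius a/2, so that the doubled boxes of the reverse Hölder inequality have the radius aL of
  -- the chains.
  obtain ⟨F, hF, hcov⟩ := exists_finset_cover (n := n) (p := p) (half_pos ha) γ'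
  set β : ℝ≥0∞ := ENNReal.ofReal (2 * a ^ (n + p) / (1 - γ')) with hβ
  set N : ℝ≥0∞ := (F.card : ℝ≥0∞) with hN
  set C : ℝ≥0∞ := N ^ s * ((C₁ : ℝ≥0∞) ^ s * (N * C₂) * β ^ (1 + s)) with hC
  have hNt : N ≠ ∞ := ENNReal.natCast_ne_top _
  have hCt : C ≠ ∞ := by
    have h1 := ENNReal.rpow_ne_top_of_nonneg hs0.le hNt
    have h2 := ENNReal.rpow_ne_top_of_nonneg hs0.le (ENNReal.coe_ne_top (r := C₁))
    have h3 : β ^ (1 + s) ≠ ∞ :=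
      ENNReal.rpow_ne_top_of_nonneg (by positivity) ENNReal.ofReal_ne_top
    finiteness
  refine ⟨C.toNNReal, fun W hW hWt hA x t L hL => ?_⟩
  rw [hsε, ENNReal.coe_toNNReal hCt]
  have hexp : ∀ z, W z ^ (1 / (1 - (1 + s))) = (W z ^ (1 / (1 - q))) ^ (1 + δ) := fun z => by
    rw [← ENNReal.rpow_mul]
    congr 1
    rw [show 1 - (1 + s) = -s by ring, show 1 - q = -(q - 1) by ring, one_div, one_div, inv_neg,
      inv_neg, hs, inv_div]
    ring
  simp only [hexp]
  rw [show 1 + s - 1 = s by ring]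
  set σ : (Fin n → ℝ) × ℝ → ℝ≥0∞ := fun y => W y ^ (1 / (1 - q)) with hσ
  have hσm : Measurable σ := hW.pow_const _
  set m := volume (upperPart p γ' x t L) with hm
  set b : ℝ≥0∞ := ENNReal.ofReal (2 ^ (n + 1) * (a * L) ^ (n + p)) with hb
  have hvb : ∀ z, volume (box p z (a * L)) = b := fun z => volume_box _ _ (by positivity)
  have hb0 : b ≠ 0 := by rw [hb, Ne, ENNReal.ofReal_eq_zero, not_le]; positivity
  have hbt : b ≠ ∞ := ENNReal.ofReal_ne_top
  have hbm : b = β * m := by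
    rw [← hvb 0]; exact volume_box_eq_mul_volume_upperPart hγ'1 ha hL x t 0
  set A := ∫⁻ z in lowerPart p γ' x t L, W z with hAdef
  have hR : 0 < a / 2 * L := by positivity
  have hRa : 2 * (a / 2 * L) = a * L := by ring
  have hsumA : A ≤ ∑ g ∈ F, ∫⁻ z in box p (x + L • g.1, t - L ^ p * g.2) (a * L), W z := by
    calc A ≤ ∫⁻ z in ⋃ g ∈ F, box p (x + L • g.1, t - L ^ p * g.2) (a * L), W z := by
          refine lintegral_mono_set ((hcov x t L hL).2.trans ?_)
          exact iUnion₂_mono fun g _ => box_subset_box (by linarith) _ hR.le (by linarith)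
      _ ≤ _ := setLIntegral_biUnion_finset_le _ _ _
  have hsumY : ∫⁻ z in upperPart p γ' x t L, σ z ^ (1 + δ) ≤
      ∑ f ∈ F, ∫⁻ z in box p (x + L • f.1, t + L ^ p * f.2) (a / 2 * L), σ z ^ (1 + δ) :=
    (lintegral_mono_set (hcov x t L hL).1).trans (setLIntegral_biUnion_finset_le _ _ _)
  have hLp : 0 < L ^ p := by positivity
  have hAI : ∀ f ∈ F, A * (∫⁻ z in box p (x + L • f.1, t + L ^ p * f.2) (a * L), σ z) ^ (q - 1) ≤
      N * C₂ * b ^ q := by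
    intro f hf
    calc _ ≤ (∑ g ∈ F, ∫⁻ z in box p (x + L • g.1, t - L ^ p * g.2) (a * L), W z) *
          (∫⁻ z in box p (x + L • f.1, t + L ^ p * f.2) (a * L), σ z) ^ (q - 1) := by gcongr
      _ ≤ F.card • (C₂ * b ^ q) := by
          rw [Finset.sum_mul]
          refine Finset.sum_le_card_nsmul F _ _ fun g hg => ?_
          -- The lag L^p (f.2 + g.2) lies between 2γ'L^p and 2L^p, so every pair of boxes is joined
          -- by a chain.
          refine hC₂ W hW hWt hA L hL _ _ (fun i => ?_) ?_ ?_
          · have h1 := abs_le.mp ((hF f hf).1 i)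
            have h2 := abs_le.mp ((hF g hg).1 i)
            simp only [Pi.add_apply, Pi.smul_apply, smul_eq_mul]
            rw [show x i + L * f.1 i - (x i + L * g.1 i) = L * (f.1 i - g.1 i) by ring, abs_mul,
              abs_of_pos hL, mul_comm]
            gcongr
            rw [abs_le]
            constructor <;> linarith
          · have h1 := (hF f hf).2.1
            have h2 := (hF g hg).2.1
            simp only
            nlinarith
          · have h1 := (hF f hf).2.2
            have h2 := (hF g hg).2.2
            simp only
            nlinarith
      _ = _ := by rw [nsmul_eq_mul, mul_assoc]
  have hY : ∀ f ∈ F,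
      A * (∫⁻ z in box p (x + L • f.1, t + L ^ p * f.2) (a / 2 * L), σ z ^ (1 + δ)) ^ s ≤
        C₁ ^ s * (N * C₂) * b ^ (1 + s) := by
    intro f hf
    refine mul_rpow_le_of_reverse_holder hq hδ hb0 hbt (by finiteness) (hAI f hf) fun hI => ?_
    have := hRH σ hσm (x + L • f.1, t + L ^ p * f.2) _ hR (by rwa [hRa]) fun z r hr hsub => ?_
    · rwa [hRa, hvb] at this
    · refine hsuper W hW hWt hA z r hr (ne_top_of_le_ne_top hI (lintegral_mono_set ?_))
      rw [← hRa]
      exact (box_subset_box (by linarith) z hr.le (by nlinarith)).trans hsub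
  calc A * (∫⁻ z in upperPart p γ' x t L, σ z ^ (1 + δ)) ^ s
      ≤ A * (∑ f ∈ F, ∫⁻ z in box p (x + L • f.1, t + L ^ p * f.2) (a / 2 * L),
          σ z ^ (1 + δ)) ^ s := by gcongr
    _ ≤ N ^ s * (C₁ ^ s * (N * C₂) * b ^ (1 + s)) := mul_sum_rpow_le F _ hs0 hY
    _ = C * m ^ (1 + s) := by
      rw [hbm, ENNReal.mul_rpow_of_nonneg _ _ (by positivity), hC]; ring

/-! ### From averages to integrals, and the conclusion -/

theorem laverage_mul_laverage_rpow_le_iff (hq : 1 < q) {γ' L : ℝ} (hγ' : γ' < 1) (hL : 0 < L)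
    (x : Fin n → ℝ) (t : ℝ) (f g : (Fin n → ℝ) × ℝ → ℝ≥0∞) (K : ℝ≥0∞) :
    (⨍⁻ z in lowerPart p γ' x t L, f z ∂volume) *
      (⨍⁻ z in upperPart p γ' x t L, g z ∂volume) ^ (q - 1) ≤
        K ↔
      (∫⁻ z in lowerPart p γ' x t L, f z) * (∫⁻ z in upperPart p γ' x t L, g z) ^ (q - 1) ≤
        K * volume (upperPart p γ' x t L) ^ q := by
  have hq1 : 0 < q - 1 := by linarith
  have h1 : 0 < 1 - γ' := by linarith
  have hv : volume (lowerPart p γ' x t L) = volume (upperPart p γ' x t L) := by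
    rw [volume_lowerPart _ _ hL, volume_upperPart _ _ hL]
  rw [setLAverage_eq, setLAverage_eq, hv]
  set m := volume (upperPart p γ' x t L) with hm
  have hm' : m = ENNReal.ofReal (2 ^ n * (1 - γ') * L ^ (n + p)) := volume_upperPart _ _ hL
  have hm0 : m ≠ 0 := by rw [hm', Ne, ENNReal.ofReal_eq_zero, not_le]; positivity
  have hmt : m ≠ ∞ := by rw [hm']; exact ENNReal.ofReal_ne_top
  have hmq0 : m ^ q ≠ 0 := (ENNReal.rpow_pos (pos_iff_ne_zero.mpr hm0) hmt).ne'
  have hmqt : m ^ q ≠ ∞ := ENNReal.rpow_ne_top_of_nonneg (by linarith) hmt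
  rw [← ENNReal.div_le_iff_le_mul (Or.inl hmq0) (Or.inl hmqt)]
  refine iff_of_eq (congrArg (· ≤ K) ?_)
  have e : m ^ q = m * m ^ (q - 1) := by
    nth_rewrite 2 [← ENNReal.rpow_one m]
    rw [← ENNReal.rpow_add _ _ hm0 hmt, add_sub_cancel]
  rw [ENNReal.div_rpow_of_nonneg _ _ hq1.le, e, div_eq_mul_inv, div_eq_mul_inv, div_eq_mul_inv,
    ENNReal.mul_inv (Or.inl hm0) (Or.inl hmt)]
  ring

theorem aqPlusConst_le_iff (hq : 1 < q) {γ' : ℝ} (hγ' : γ' < 1) {w : (Fin n → ℝ) × ℝ → ℝ}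
    {W : (Fin n → ℝ) × ℝ → ℝ≥0∞} (hW : (fun z => ENNReal.ofReal (w z)) =ᵐ[volume] W) (K : ℝ≥0∞) :
    aqPlusConst p q γ' w ≤ K ↔ HasAqPlusBound p q γ' K W := by
  simp only [aqPlusConst, iSup_le_iff, HasAqPlusBound]
  refine forall_congr' fun x => forall_congr' fun t => forall₂_congr fun L hL => ?_
  rw [laverage_mul_laverage_rpow_le_iff hq hγ' hL,
    lintegral_congr_ae (ae_restrict_of_ae hW)]
  rw [lintegral_congr_ae (ae_restrict_of_ae (hW.mono fun z hz => congrArg (· ^ (1 / (1 - q))) hz) :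
    (fun z => ENNReal.ofReal (w z) ^ (1 / (1 - q)))
      =ᵐ[volume.restrict (upperPart p γ' x t L)] fun z => W z ^ (1 / (1 - q)))]

end ParabolicWeights

theorem mainTheorem8 (n : ℕ) (hn : 1 ≤ n) (p q γ : ℝ) (hp : 1 < p) (hq : 1 < q)
    (hγ0 : 0 < γ) (hγ1 : γ < 1) (K : ℝ≥0) :
    ∃ ε : ℝ, 0 < ε ∧ ε < q - 1 ∧
      ∀ γ' : ℝ, 0 < γ' → γ' < 1 →
        ∃ C : ℝ≥0, ∀ w : (Fin n → ℝ) × ℝ → ℝ,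
          ParabolicWeights.MemAqPlus p q γ w →
          ParabolicWeights.aqPlusConst p q γ w ≤ (K : ℝ≥0∞) →
            ParabolicWeights.MemAqPlus p (q - ε) γ' w ∧
              ParabolicWeights.aqPlusConst p (q - ε) γ' w ≤ (C : ℝ≥0∞) := by
  obtain ⟨ε, hε, hεq, h⟩ := ParabolicWeights.exists_hasAqPlusBound_sub n hp hq hγ0 hγ1 K
  refine ⟨ε, hε, hεq, fun γ' hγ'0 hγ'1 => ?_⟩
  obtain ⟨C, hC⟩ := h γ' hγ'0 hγ'1
  refine ⟨C, fun w hw hK => ?_⟩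
  -- The constants see w only up to null sets, so a measurable representative may be used.
  have hwm := hw.isWeight.locallyIntegrable.aestronglyMeasurable
  have hW : (fun z => ENNReal.ofReal (w z)) =ᵐ[volume] fun z => ENNReal.ofReal (hwm.mk w z) :=
    hwm.ae_eq_mk.mono fun z hz => by simp only [hz]
  have hbound : ParabolicWeights.aqPlusConst p (q - ε) γ' w ≤ (C : ℝ≥0∞) := by
    rw [ParabolicWeights.aqPlusConst_le_iff (by linarith) hγ'1 hW]
    refine hC _ hwm.stronglyMeasurable_mk.measurable.ennreal_ofReal
      (fun z => ENNReal.ofReal_ne_top) ?_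
    rwa [← ParabolicWeights.aqPlusConst_le_iff hq hγ1 hW]
  exact ⟨⟨hw.isWeight, hbound.trans_lt ENNReal.coe_lt_top⟩, hbound⟩
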